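/- Let $\xi_0,\xi_1,\dots$ be i.i.d. standard complex Gaussian random variables (Lebesgue density $\pi^{-1}e^{-|z|^2}$ on $\mathbb C$) and let $$G(z)=\sum_{n=0}^\infty \xi_n\frac{z^n}{\sqrt{n!}}$$ be the plane Gaussian analytic function. For an entire function $F$ and $\tau\in\mathbb C$ put, whenever the series converges, $$\bigl(e^{-\tau D^2/2}F\bigr)(z)=\sum_{k=0}^\infty\frac1{k!}\Bigl(-\frac{\tau}{2}\Bigr)^kF^{(2k)}(z).$$ Let $\tau\in\mathbb C$ with $|\tau|<1$ and let $$(V_\tau G)(z)=(1-|\tau|^2)^{1/4}\,e^{\bar\tau z^2/2}\,\bigl(e^{-\tau D^2/2}G\bigr)\bigl(z\sqrt{1-|\tau|^2}\bigr).$$ Then $V_\tau G$ is well defined: almost surely, the series defining $G(z)$ and $(e^{-\tau D^2/2}G)(z)$ converge absolutely for every $z\in\mathbb C$, and $G$, $e^{-\tau D^2/2}G$ and $V_\tau G$ are entire functions. Moreover $V_\tau G$ has the same distribution as $G$, as a random element of the space of entire functions with the Borel $\sigma$-algebra of locally uniform convergence. In particular, writing $\mathcal Z(F)=\sum_{z:\,F(z)=0}\delta_z$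 for the point process of zeros of $F$ (counted with multiplicity) and $a\cdot\mathcal Z(F)$ for its image under $z\mapsto az$, $$\frac{\mathcal Z(e^{-\tau D^2/2}G)}{\sqrt{1-|\tau|^2}}=\mathcal Z(V_\tau G)\ \text{ almost surely},\qquad \mathcal Z(V_\tau G)\stackrel{d}{=}\mathcal Z(G),$$ so that $\mathcal Z(e^{-\tau D^2/2}G)/\sqrt{1-|\tau|^2}\stackrel{d}{=}\mathcal Z(G)$. -/

import Mathlib

open MeasureTheory ProbabilityTheory Filter Topology
open scoped ENNReal NNReal

noncomputable section

/-- The standard complex Gaussian distribution: Lebesgue density `π⁻¹ exp (-|z|²)` on `ℂ`. -/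
def stdComplexGaussian : Measure ℂ :=
  (volume : Measure ℂ).withDensity
    (fun z => ENNReal.ofReal (Real.pi⁻¹ * Real.exp (-‖z‖ ^ 2)))

/-- The function `z ↦ ∑ aₙ zⁿ / √(n!)`.  For i.i.d. standard complex Gaussian coefficients `aₙ`
this is the plane Gaussian analytic function. -/
def planeGAF (a : ℕ → ℂ) (z : ℂ) : ℂ :=
  ∑' n : ℕ, a n * (z ^ n / (Real.sqrt (n.factorial : ℝ) : ℂ))

/-- The `k`-th term `(1/k!) (-τ/2)^k (D^{2k} F)(z)` of the heat-flow series. -/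
def heatTerm (τ : ℂ) (F : ℂ → ℂ) (z : ℂ) (k : ℕ) : ℂ :=
  (1 / (k.factorial : ℂ)) * (-τ / 2) ^ k * iteratedDeriv (2 * k) F z

/-- The heat flow `e^{-τ D²/2} F`, defined by its power series in `D²`. -/
def heatFlow (τ : ℂ) (F : ℂ → ℂ) (z : ℂ) : ℂ :=
  ∑' k : ℕ, heatTerm τ F z k

/-- The scaling factor `√(1 - |τ|²)`. -/
def heatScale (τ : ℂ) : ℝ := Real.sqrt (1 - ‖τ‖ ^ 2)

/-- `(V_τ F)(z) = (1 - |τ|²)^{1/4} e^{τ̄ z²/2} (e^{-τ D²/2} F)(z √(1 - |τ|²))`. -/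
def heatV (τ : ℂ) (F : ℂ → ℂ) (z : ℂ) : ℂ :=
  (((1 - ‖τ‖ ^ 2) ^ (1 / 4 : ℝ) : ℝ) : ℂ) *
    Complex.exp ((starRingEnd ℂ) τ * z ^ 2 / 2) *
    heatFlow τ F (z * (heatScale τ : ℂ))

/-- The space of entire functions. -/
def EntireFunction : Type := {f : C(ℂ, ℂ) // Differentiable ℂ f}

/-- The topology of locally uniform convergence (the compact-open topology). -/
instance : TopologicalSpace EntireFunction :=
  inferInstanceAs (TopologicalSpace {f : C(ℂ, ℂ) // Differentiable ℂ f})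

/-- The Borel σ-algebra of the topology of locally uniform convergence. -/
instance : MeasurableSpace EntireFunction := borel EntireFunction

instance : BorelSpace EntireFunction := ⟨rfl⟩

open Classical in
/-- An entire function `F : ℂ → ℂ` as an element of the space of entire functions (with the
value `0` when `F` is not entire). -/
def toEntire (F : ℂ → ℂ) : EntireFunction :=
  if h : Differentiable ℂ F then ⟨⟨F, h.continuous⟩, h⟩ else ⟨0, differentiable_const 0⟩

/-- The collection of zeros of `F`, as the counting measure `∑ δ_z` over the zeros `z` of `F`
repeated according to multiplicity. -/
def zeroMeasure (F : ℂ → ℂ) : Measure ℂ :=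
  Measure.sum (fun z : {z : ℂ // F z = 0} =>
    ((analyticOrderAt F (z : ℂ) : ℕ∞) : ℝ≥0∞) • Measure.dirac (z : ℂ))

/-- The collection of zeros of `F`, each divided by the number `s`. -/
def scaledZeroMeasure (s : ℝ) (F : ℂ → ℂ) : Measure ℂ :=
  (zeroMeasure F).map (fun z : ℂ => z / (s : ℂ))

end

/-!
The Gaussian function `G = ∑ ξₘ eₘ`, `eₘ(z) = zᵐ / √(m!)`, and its image `V_τ G = ∑ ξₘ V_τ eₘ` are
Gaussian series in the same coefficients, so their laws are determined by their covariance kernels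
`∑ eₘ(z) conj (eₘ(w)) = exp (z w̄)` and `∑ V_τ eₘ(z) conj (V_τ eₘ(w))`; the theorem says that the
two kernels agree.

* *Convergence.* Almost surely `|ξₘ| ≤ C Aᵐ`, for any fixed `A > 1` (`ae_exists_growth`). If
  `A² |τ| < 1`, the double series of all derivatives of all monomials converges absolutely and
  locally uniformly (`summable_pow_mul_heatTermBound`), so that the heat flow acts on `G` termwise
  and yields an entire function.
* *Kernel.* With `c² = -τ`, the heat flow of a monomial is its Gaussian mean,
  `(e^{-τ D²/2} eₘ)(z) = E eₘ(z + c u)` with `u` real standard normal. Taking this mean in the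
  conjugate of the generating function `∑ eₘ(z) (e^{-τ D²/2} eₘ)(w) = exp (z w - τ z² / 2)` leaves
  a one-dimensional Gaussian integral, which gives Mehler's formula
  `hasSum_heatFlow_mul_conj_heatFlow`; the prefactor and the dilation in `V_τ` turn its
  right-hand side into `exp (z w̄)`. The quadratic coefficient of the
  integral is `-(1 - |τ|²) / 2`, which is real: no branch of a square root has to be chosen.
* *Law.* Joint characteristic functions at finitely many points depend only on the kernel
  (`map_eq_map_of_hasSum_of_kernel_eq`), and evaluations generate the Borel `σ`-algebra of locally
  uniform convergence (`borel_entireFunction_eq_comap`).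
* *Zeros.* The zero measure of `F` is the sum over `m ≥ 1` of the counting measures of the sets of
  zeros of order at least `m`. Each of these sets is closed and cut out by the derivatives of `F`,
  so the event that it meets a given compact set is measurable; counting disjoint small discs met
  by the set gives measurability of `F ↦ zeroMeasure F` (`measurable_zeroMeasure`). Equality in law
  of the zeros then follows from that of the functions, and the almost sure identity of zeros holds
  because `V_τ G` is the dilated heat flow times a nowhere vanishing function.
-/

noncomputable section

open scoped ComplexConjugate

/-! ### Entire series with coefficients of at most geometric growth -/

/-- The normalised monomial `z ↦ zⁿ / √(n!)`. -/
def gafBasis (n : ℕ) (z : ℂ) : ℂ := z ^ n / (Real.sqrt (n.factorial : ℝ) : ℂ)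

/-- The square of the left-hand side is a single term of the series of `exp (r²)`. -/
lemma pow_div_sqrt_factorial_le_exp (r : ℝ) (n : ℕ) :
    r ^ n / Real.sqrt (n.factorial : ℝ) ≤ Real.exp (r ^ 2 / 2) := by
  have h := Real.pow_div_factorial_le_exp (r ^ 2) (sq_nonneg r) n
  have h1 : (r ^ n / Real.sqrt (n.factorial : ℝ)) ^ 2 ≤ (Real.exp (r ^ 2 / 2)) ^ 2 := by
    rw [div_pow, Real.sq_sqrt (by positivity), ← Real.exp_nat_mul, ← pow_mul, mul_comm n 2, pow_mul]
    convert h using 2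
    push_cast; ring
  exact le_of_sq_le_sq h1 (Real.exp_pos _).le

lemma norm_gafBasis (n : ℕ) (z : ℂ) :
    ‖gafBasis n z‖ = ‖z‖ ^ n / Real.sqrt (n.factorial : ℝ) := by
  rw [gafBasis, norm_div, norm_pow, Complex.norm_real, Real.norm_of_nonneg (Real.sqrt_nonneg _)]

lemma norm_gafBasis_le (n : ℕ) (z : ℂ) : ‖gafBasis n z‖ ≤ Real.exp (‖z‖ ^ 2 / 2) := by
  rw [norm_gafBasis]; exact pow_div_sqrt_factorial_le_exp _ n

lemma summable_pow_div_sqrt_factorial {c : ℝ} (hc : 0 ≤ c) :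
    Summable fun n : ℕ => c ^ n / Real.sqrt (n.factorial : ℝ) := by
  refine Summable.of_nonneg_of_le (fun n => by positivity) (fun n => ?_)
    ((summable_geometric_of_lt_one (by norm_num : (0 : ℝ) ≤ 1 / 2) (by norm_num)).mul_left
      (Real.exp ((2 * c) ^ 2 / 2)))
  have h := pow_div_sqrt_factorial_le_exp (2 * c) n
  have e : c ^ n / Real.sqrt (n.factorial : ℝ) =
      (2 * c) ^ n / Real.sqrt (n.factorial : ℝ) * (1 / 2) ^ n := by
    rw [mul_pow, one_div, inv_pow]; field_simp
  rw [e]; gcongr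

lemma iteratedDeriv_gafBasis (m j : ℕ) (z : ℂ) :
    iteratedDeriv j (gafBasis m) z =
      m.descFactorial j * z ^ (m - j) / (Real.sqrt (m.factorial : ℝ) : ℂ) := by
  have : gafBasis m = fun z => (Real.sqrt (m.factorial : ℝ) : ℂ)⁻¹ * z ^ m := by
    ext z; rw [gafBasis, div_eq_inv_mul]
  rw [this, iteratedDeriv_const_mul_field, iteratedDeriv_pow, div_eq_inv_mul]

lemma differentiable_iteratedDeriv_gafBasis (m j : ℕ) :
    Differentiable ℂ (iteratedDeriv j (gafBasis m)) := by
  have : iteratedDeriv j (gafBasis m) = fun z =>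
      m.descFactorial j * z ^ (m - j) / (Real.sqrt (m.factorial : ℝ) : ℂ) :=
    funext (iteratedDeriv_gafBasis m j)
  rw [this]; fun_prop

lemma differentiable_heatTerm_gafBasis (τ : ℂ) (m k : ℕ) :
    Differentiable ℂ fun z => heatTerm τ (gafBasis m) z k := by
  unfold heatTerm
  exact (differentiable_iteratedDeriv_gafBasis m (2 * k)).const_mul _

/-- The falling factorial is absorbed into a geometric factor by `mʲ ≤ j! eᵐ`. -/
lemma norm_iteratedDeriv_gafBasis_le (m j : ℕ) {R : ℝ} (hR : 1 ≤ R) {z : ℂ} (hz : ‖z‖ ≤ R) :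
    ‖iteratedDeriv j (gafBasis m) z‖ ≤
      j.factorial * ((R * Real.exp 1) ^ m / Real.sqrt (m.factorial : ℝ)) := by
  rw [iteratedDeriv_gafBasis, norm_div, norm_mul, norm_pow, Complex.norm_natCast,
    Complex.norm_real, Real.norm_of_nonneg (Real.sqrt_nonneg _), ← mul_div_assoc]
  refine div_le_div_of_nonneg_right ?_ (Real.sqrt_nonneg _)
  have h1 : (m.descFactorial j : ℝ) ≤ j.factorial * Real.exp 1 ^ m := by
    have h := Real.pow_div_factorial_le_exp (m : ℝ) (by positivity) j
    rw [div_le_iff₀ (by positivity)] at h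
    calc (m.descFactorial j : ℝ) ≤ (m : ℝ) ^ j := by exact_mod_cast Nat.descFactorial_le_pow m j
      _ ≤ _ := h
      _ = _ := by rw [mul_comm, ← Real.exp_nat_mul, mul_one]
  have h2 : ‖z‖ ^ (m - j) ≤ R ^ m :=
    (pow_le_pow_left₀ (norm_nonneg _) hz _).trans (pow_le_pow_right₀ hR (Nat.sub_le _ _))
  calc (m.descFactorial j : ℝ) * ‖z‖ ^ (m - j) ≤ (j.factorial * Real.exp 1 ^ m) * R ^ m := by gcongr
    _ = _ := by rw [mul_pow]; ring

/-! In this section `‖a m‖ ≤ C * A ^ m` is the growth condition on the coefficients. The heat flow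
at time `τ` needs it with some `A` such that `A ^ 2 * ‖τ‖ < 1`. -/

section Growth

variable {a : ℕ → ℂ} {A C : ℝ}

lemma nonneg_of_growth (ha : ∀ m, ‖a m‖ ≤ C * A ^ m) : 0 ≤ C := by
  simpa using (norm_nonneg _).trans (ha 0)

lemma summable_growth_iteratedDeriv_bound (hA : 0 ≤ A) (j : ℕ) {R : ℝ} (hR : 1 ≤ R) :
    Summable fun m : ℕ => C * A ^ m *
      (j.factorial * ((R * Real.exp 1) ^ m / Real.sqrt (m.factorial : ℝ))) := by
  refine ((summable_pow_div_sqrt_factorial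
    (by positivity : 0 ≤ A * (R * Real.exp 1))).mul_left (C * j.factorial)).congr (fun m => ?_)
  rw [mul_pow A]; ring

lemma norm_mul_iteratedDeriv_gafBasis_le (hA : 0 ≤ A) (ha : ∀ m, ‖a m‖ ≤ C * A ^ m) (j m : ℕ)
    {R : ℝ} (hR : 1 ≤ R) {z : ℂ} (hz : ‖z‖ ≤ R) :
    ‖a m * iteratedDeriv j (gafBasis m) z‖ ≤ C * A ^ m *
      (j.factorial * ((R * Real.exp 1) ^ m / Real.sqrt (m.factorial : ℝ))) := by
  have := nonneg_of_growth ha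
  rw [norm_mul]
  exact mul_le_mul (ha m) (norm_iteratedDeriv_gafBasis_le m j hR hz) (norm_nonneg _) (by positivity)

lemma summable_mul_iteratedDeriv_gafBasis (hA : 0 ≤ A) (ha : ∀ m, ‖a m‖ ≤ C * A ^ m) (j : ℕ)
    (z : ℂ) : Summable fun m => a m * iteratedDeriv j (gafBasis m) z :=
  .of_norm_bounded (summable_growth_iteratedDeriv_bound hA j (le_max_left 1 ‖z‖))
    (fun m => norm_mul_iteratedDeriv_gafBasis_le hA ha j m (le_max_left _ _) (le_max_right _ _))

lemma summable_planeGAF (hA : 0 ≤ A) (ha : ∀ m, ‖a m‖ ≤ C * A ^ m) (z : ℂ) :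
    Summable fun m => a m * gafBasis m z := by
  simpa using summable_mul_iteratedDeriv_gafBasis hA ha 0 z

lemma hasSum_planeGAF (hA : 0 ≤ A) (ha : ∀ m, ‖a m‖ ≤ C * A ^ m) (z : ℂ) :
    HasSum (fun m => a m * gafBasis m z) (planeGAF a z) :=
  (summable_planeGAF hA ha z).hasSum

/-- The power series of `planeGAF a` may be differentiated termwise. -/
lemma iteratedDeriv_planeGAF (hA : 0 ≤ A) (ha : ∀ m, ‖a m‖ ≤ C * A ^ m) (j : ℕ) :
    iteratedDeriv j (planeGAF a) = fun z => ∑' m, a m * iteratedDeriv j (gafBasis m) z := by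
  induction j with
  | zero => ext z; simp [planeGAF, gafBasis]
  | succ j ih =>
    ext z
    rw [iteratedDeriv_succ, ih]
    have hR : (1 : ℝ) ≤ ‖z‖ + 1 := by simp
    have h := Complex.hasSum_deriv_of_summable_norm (U := Metric.ball 0 (‖z‖ + 1)) (z := z)
      (F := fun m z => a m * iteratedDeriv j (gafBasis m) z)
      (summable_growth_iteratedDeriv_bound (C := C) hA j hR)
      (fun m => ((differentiable_iteratedDeriv_gafBasis m j).const_mul _).differentiableOn)
      Metric.isOpen_ball
      (fun m w hw => norm_mul_iteratedDeriv_gafBasis_le hA ha j m hR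
        (by simpa using (Metric.mem_ball.1 hw).le)) (by simp)
    rw [← h.tsum_eq]
    congr 1; ext m
    rw [deriv_const_mul _ (differentiable_iteratedDeriv_gafBasis m j z), iteratedDeriv_succ]

lemma differentiable_planeGAF (hA : 0 ≤ A) (ha : ∀ m, ‖a m‖ ≤ C * A ^ m) :
    Differentiable ℂ (planeGAF a) := by
  intro z
  have hR : (1 : ℝ) ≤ ‖z‖ + 1 := by simp
  have h := Complex.differentiableOn_tsum_of_summable_norm (U := Metric.ball 0 (‖z‖ + 1))
      (F := fun m z => a m * iteratedDeriv 0 (gafBasis m) z)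
      (summable_growth_iteratedDeriv_bound (C := C) hA 0 hR)
      (fun m => ((differentiable_iteratedDeriv_gafBasis m 0).const_mul _).differentiableOn)
      Metric.isOpen_ball
      (fun m w hw => norm_mul_iteratedDeriv_gafBasis_le hA ha 0 m hR
        (by simpa using (Metric.mem_ball.1 hw).le))
  simp only [iteratedDeriv_zero] at h
  exact h.differentiableAt (Metric.isOpen_ball.mem_nhds (by simp))

/-- A bound for the `k`-th heat-flow term of the `m`-th normalised monomial on the disc of
radius `R`, where `t = |τ|`. -/
def heatTermBound (t R : ℝ) (k m : ℕ) : ℝ :=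
  1 / k.factorial * (t / 2) ^ k * (m.descFactorial (2 * k) * R ^ (m - 2 * k) /
    Real.sqrt (m.factorial : ℝ))

lemma heatTermBound_nonneg {t R : ℝ} (ht : 0 ≤ t) (hR : 0 ≤ R) (k m : ℕ) :
    0 ≤ heatTermBound t R k m := by unfold heatTermBound; positivity

lemma norm_heatTerm_gafBasis_le (τ : ℂ) (k m : ℕ) {R : ℝ} {z : ℂ} (hz : ‖z‖ ≤ R) :
    ‖heatTerm τ (gafBasis m) z k‖ ≤ heatTermBound ‖τ‖ R k m := by
  rw [heatTerm, iteratedDeriv_gafBasis, heatTermBound]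
  simp only [norm_div, norm_mul, norm_pow, Complex.norm_natCast, norm_neg, norm_one,
    Complex.norm_real, Real.norm_of_nonneg (Real.sqrt_nonneg _), Complex.norm_ofNat]
  gcongr

lemma factorial_two_mul_le (k : ℕ) : (2 * k).factorial ≤ 4 ^ k * k.factorial ^ 2 := by
  have h := Nat.choose_mul_factorial_mul_factorial (show k ≤ 2 * k by omega)
  have h2 : 2 * k - k = k := by omega
  rw [h2] at h
  have h3 : (2 * k).choose k ≤ 4 ^ k := by
    calc (2 * k).choose k ≤ 2 ^ (2 * k) := Nat.choose_le_two_pow _ _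
      _ = 4 ^ k := by rw [pow_mul]; norm_num
  rw [← h, sq, mul_assoc]
  exact Nat.mul_le_mul_right _ h3

/-- The binomial bound `binom (n + 2k) n xⁿ ≤ (1 + x) ^ (n + 2k)` separates the two summation
variables `n = m - 2k` and `k`. -/
lemma pow_mul_heatTermBound_le {t R x : ℝ} (hA : 0 ≤ A) (ht : 0 ≤ t) (hR : 0 ≤ R) (hx : 0 < x)
    (k n : ℕ) :
    A ^ (n + 2 * k) * heatTermBound t R k (n + 2 * k) ≤
      (A ^ 2 * (1 + x) * t) ^ k *
        ((A * R * Real.sqrt ((1 + x) / x)) ^ n / Real.sqrt (n.factorial : ℝ)) := by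
  have hfac : ((n + 2 * k).factorial : ℝ) = (n + 2 * k).descFactorial (2 * k) * n.factorial := by
    have h := Nat.factorial_mul_descFactorial (show 2 * k ≤ n + 2 * k by omega)
    rw [Nat.add_sub_cancel] at h
    rw [← h]; push_cast; ring
  have hbin : ((n + 2 * k).descFactorial (2 * k) : ℝ) ≤
      (2 ^ k * k.factorial * (1 + x) ^ k * Real.sqrt ((1 + x) / x) ^ n) ^ 2 := by
    have h1 : x ^ n * ((n + 2 * k).choose n : ℝ) ≤ (1 + x) ^ (n + 2 * k) := by
      have h := add_pow x 1 (n + 2 * k)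
      rw [add_comm 1 x, h]
      refine le_trans (le_of_eq ?_) (Finset.single_le_sum
        (f := fun m => x ^ m * 1 ^ (n + 2 * k - m) * ((n + 2 * k).choose m : ℝ))
        (fun i _ => by positivity) (Finset.mem_range.2 (by omega : n < n + 2 * k + 1)))
      simp
    have h2 : ((n + 2 * k).descFactorial (2 * k) : ℝ) =
        (2 * k).factorial * (n + 2 * k).choose n := by
      rw [Nat.descFactorial_eq_factorial_mul_choose, Nat.choose_symm_add]; push_cast; ring
    have h3 : ((2 * k).factorial : ℝ) ≤ 4 ^ k * (k.factorial : ℝ) ^ 2 := by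
      exact_mod_cast factorial_two_mul_le k
    have h4 : ((n + 2 * k).choose n : ℝ) ≤ (1 + x) ^ (n + 2 * k) / x ^ n := by
      rw [le_div_iff₀ (by positivity)]; linarith
    rw [h2]
    calc ((2 * k).factorial : ℝ) * (n + 2 * k).choose n
        ≤ (4 ^ k * (k.factorial : ℝ) ^ 2) * ((1 + x) ^ (n + 2 * k) / x ^ n) := by gcongr
      _ = _ := by
        have e : (Real.sqrt ((1 + x) / x) ^ n) ^ 2 = ((1 + x) / x) ^ n := by
          rw [← pow_mul, mul_comm, pow_mul, Real.sq_sqrt (by positivity)]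
        rw [mul_pow, mul_pow, mul_pow, e, div_pow, pow_add, ← pow_mul, ← pow_mul,
          mul_comm k 2, pow_mul 2]
        norm_num
        ring
  set d : ℝ := ((n + 2 * k).descFactorial (2 * k) : ℝ) with hd
  have hd0 : 0 < d := by
    rw [hd]; exact_mod_cast Nat.descFactorial_pos.2 (by omega)
  have hsq : Real.sqrt d ≤ 2 ^ k * k.factorial * (1 + x) ^ k * Real.sqrt ((1 + x) / x) ^ n :=
    Real.sqrt_le_iff.2 ⟨by positivity, hbin⟩
  have hsd : d / (Real.sqrt d * Real.sqrt (n.factorial : ℝ)) =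
      Real.sqrt d / Real.sqrt (n.factorial : ℝ) := by
    conv_lhs => rw [← Real.mul_self_sqrt hd0.le]
    rw [Real.sqrt_mul_self (Real.sqrt_nonneg d)]
    have := Real.sqrt_pos.2 hd0
    field_simp
  rw [heatTermBound, hfac, ← hd, Nat.add_sub_cancel, Real.sqrt_mul hd0.le]
  calc A ^ (n + 2 * k) * (1 / k.factorial * (t / 2) ^ k *
        (d * R ^ n / (Real.sqrt d * Real.sqrt (n.factorial : ℝ))))
      = A ^ (n + 2 * k) * (1 / k.factorial * (t / 2) ^ k *
        (Real.sqrt d / Real.sqrt (n.factorial : ℝ) * R ^ n)) := by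
        rw [← hsd]; ring
    _ ≤ A ^ (n + 2 * k) * (1 / k.factorial * (t / 2) ^ k *
        ((2 ^ k * k.factorial * (1 + x) ^ k * Real.sqrt ((1 + x) / x) ^ n) /
          Real.sqrt (n.factorial : ℝ) * R ^ n)) := by gcongr
    _ = _ := by
        rw [mul_pow (A * R), mul_pow A, mul_pow (A ^ 2 * (1 + x)), mul_pow (A ^ 2), div_pow,
          pow_add, pow_mul]
        field_simp

lemma summable_pow_mul_heatTermBound {t R : ℝ} (hA : 0 ≤ A) (ht : 0 ≤ t) (hR : 0 ≤ R)
    (hAt : A ^ 2 * t < 1) :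
    Summable fun p : ℕ × ℕ => A ^ p.2 * heatTermBound t R p.1 p.2 := by
  -- the terms with `m < 2k` vanish, so only the pairs `(k, n + 2k)` matter
  obtain ⟨x, hx, hx1⟩ : ∃ x : ℝ, 0 < x ∧ A ^ 2 * (1 + x) * t < 1 := by
    have hc : Tendsto (fun x : ℝ => A ^ 2 * (1 + x) * t) (𝓝[>] 0) (𝓝 (A ^ 2 * (1 + 0) * t)) :=
      ((by fun_prop : Continuous fun x : ℝ => A ^ 2 * (1 + x) * t).tendsto 0).mono_left
        nhdsWithin_le_nhds
    have h := hc.eventually (gt_mem_nhds (by simpa using hAt))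
    obtain ⟨x, h1, h2⟩ := (h.and self_mem_nhdsWithin).exists
    exact ⟨x, h2, h1⟩
  let i : ℕ × ℕ → ℕ × ℕ := fun p => (p.1, p.2 + 2 * p.1)
  have hi : Function.Injective i := by
    rintro ⟨k, n⟩ ⟨k', n'⟩ h
    simp only [i, Prod.mk.injEq] at h
    obtain ⟨rfl, h⟩ := h
    simpa using h
  rw [← hi.summable_iff]
  · refine Summable.of_nonneg_of_le (fun p => ?_)
      (fun p => pow_mul_heatTermBound_le hA ht hR hx _ _)
      ((summable_geometric_of_lt_one (by positivity) hx1).mul_of_nonneg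
        (summable_pow_div_sqrt_factorial (by positivity : 0 ≤ A * R * Real.sqrt ((1 + x) / x)))
        (fun _ => by positivity) (fun _ => by positivity))
    exact mul_nonneg (by positivity) (heatTermBound_nonneg ht hR _ _)
  · rintro ⟨k, m⟩ hp
    have hm : m < 2 * k := by
      by_contra h
      exact hp ⟨(k, m - 2 * k), by simp only [i, Prod.mk.injEq, true_and]; omega⟩
    simp [heatTermBound, Nat.descFactorial_of_lt hm]

lemma norm_mul_heatTerm_gafBasis_le (hA : 0 ≤ A) (ha : ∀ m, ‖a m‖ ≤ C * A ^ m) (τ : ℂ) {R : ℝ}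
    {z : ℂ} (hz : ‖z‖ ≤ R) (p : ℕ × ℕ) :
    ‖a p.2 * heatTerm τ (gafBasis p.2) z p.1‖ ≤
      C * (A ^ p.2 * heatTermBound ‖τ‖ R p.1 p.2) := by
  have := nonneg_of_growth ha
  rw [norm_mul, ← mul_assoc]
  exact mul_le_mul (ha _) (norm_heatTerm_gafBasis_le τ _ _ hz) (norm_nonneg _) (by positivity)

variable {τ : ℂ}

lemma summable_mul_heatTerm_gafBasis (hA : 0 ≤ A) (ha : ∀ m, ‖a m‖ ≤ C * A ^ m)
    (hτ : A ^ 2 * ‖τ‖ < 1) (z : ℂ) :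
    Summable fun p : ℕ × ℕ => a p.2 * heatTerm τ (gafBasis p.2) z p.1 :=
  .of_norm_bounded
    ((summable_pow_mul_heatTermBound hA (norm_nonneg _) (norm_nonneg z) hτ).mul_left C)
    (norm_mul_heatTerm_gafBasis_le hA ha τ le_rfl)

lemma heatTerm_planeGAF (hA : 0 ≤ A) (ha : ∀ m, ‖a m‖ ≤ C * A ^ m) (z : ℂ) (k : ℕ) :
    heatTerm τ (planeGAF a) z k = ∑' m, a m * heatTerm τ (gafBasis m) z k := by
  rw [heatTerm, iteratedDeriv_planeGAF hA ha, ← tsum_mul_left]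
  congr 1; ext m
  rw [heatTerm]; ring

lemma summable_heatTerm_planeGAF (hA : 0 ≤ A) (ha : ∀ m, ‖a m‖ ≤ C * A ^ m)
    (hτ : A ^ 2 * ‖τ‖ < 1) (z : ℂ) : Summable (heatTerm τ (planeGAF a) z) := by
  have h := (summable_mul_heatTerm_gafBasis hA ha hτ z).prod
  refine h.congr (fun k => ?_)
  rw [heatTerm_planeGAF hA ha]

lemma heatFlow_planeGAF_eq_tsum_prod (hA : 0 ≤ A) (ha : ∀ m, ‖a m‖ ≤ C * A ^ m)
    (hτ : A ^ 2 * ‖τ‖ < 1) (z : ℂ) : heatFlow τ (planeGAF a) z =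
      ∑' p : ℕ × ℕ, a p.2 * heatTerm τ (gafBasis p.2) z p.1 := by
  rw [heatFlow, (summable_mul_heatTerm_gafBasis hA ha hτ z).tsum_prod]
  congr 1; ext k
  exact heatTerm_planeGAF hA ha z k

/-- The heat flow acts on `planeGAF a` coefficient by coefficient. -/
lemma hasSum_heatFlow_planeGAF (hA : 0 ≤ A) (ha : ∀ m, ‖a m‖ ≤ C * A ^ m)
    (hτ : A ^ 2 * ‖τ‖ < 1) (z : ℂ) :
    HasSum (fun m => a m * heatFlow τ (gafBasis m) z) (heatFlow τ (planeGAF a) z) := by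
  have h := summable_mul_heatTerm_gafBasis hA ha hτ z
  have h' : Summable fun p : ℕ × ℕ => a p.1 * heatTerm τ (gafBasis p.1) z p.2 :=
    h.prod_symm
  have e : ∀ m, ∑' k, a m * heatTerm τ (gafBasis m) z k = a m * heatFlow τ (gafBasis m) z :=
    fun m => by rw [heatFlow, tsum_mul_left]
  have hs : Summable fun m => a m * heatFlow τ (gafBasis m) z := h'.prod.congr (fun m => e m)
  convert hs.hasSum using 1
  rw [heatFlow_planeGAF_eq_tsum_prod hA ha hτ, h.tsum_prod]
  have hc := Summable.tsum_comm (f := fun k m => a m * heatTerm τ (gafBasis m) z k) h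
  simp_rw [e] at hc
  exact hc.symm

lemma differentiable_heatFlow_planeGAF (hA : 0 ≤ A) (ha : ∀ m, ‖a m‖ ≤ C * A ^ m)
    (hτ : A ^ 2 * ‖τ‖ < 1) : Differentiable ℂ (heatFlow τ (planeGAF a)) := by
  intro z
  have h := Complex.differentiableOn_tsum_of_summable_norm (U := Metric.ball 0 (‖z‖ + 1))
      (F := fun (p : ℕ × ℕ) z => a p.2 * heatTerm τ (gafBasis p.2) z p.1)
      ((summable_pow_mul_heatTermBound hA (norm_nonneg _)
        (by positivity : 0 ≤ ‖z‖ + 1) hτ).mul_left C)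
      (fun p => ((differentiable_heatTerm_gafBasis τ _ _).const_mul _).differentiableOn)
      Metric.isOpen_ball
      (fun p w hw => norm_mul_heatTerm_gafBasis_le hA ha τ
        (by simpa using (Metric.mem_ball.1 hw).le) p)
  rw [funext (heatFlow_planeGAF_eq_tsum_prod hA ha hτ)]
  exact h.differentiableAt (Metric.isOpen_ball.mem_nhds (by simp))

lemma hasSum_heatV_planeGAF (hA : 0 ≤ A) (ha : ∀ m, ‖a m‖ ≤ C * A ^ m)
    (hτ : A ^ 2 * ‖τ‖ < 1) (z : ℂ) :
    HasSum (fun m => a m * heatV τ (gafBasis m) z) (heatV τ (planeGAF a) z) := by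
  have h := (hasSum_heatFlow_planeGAF hA ha hτ (z * heatScale τ)).mul_left
    ((((1 - ‖τ‖ ^ 2) ^ (1 / 4 : ℝ) : ℝ) : ℂ) * Complex.exp ((starRingEnd ℂ) τ * z ^ 2 / 2))
  refine h.congr_fun (fun m => ?_)
  rw [heatV, mul_left_comm]

end Growth

lemma differentiable_heatV {τ : ℂ} {F : ℂ → ℂ} (hF : Differentiable ℂ (heatFlow τ F)) :
    Differentiable ℂ (heatV τ F) := by
  unfold heatV
  have : Differentiable ℂ fun z : ℂ => heatFlow τ F (z * (heatScale τ : ℂ)) :=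
    hF.comp (by fun_prop : Differentiable ℂ fun z : ℂ => z * (heatScale τ : ℂ))
  fun_prop

/-! ### Mehler's formula -/

lemma gaussianPDFReal_zero_one (x : ℝ) :
    gaussianPDFReal 0 1 x = (Real.sqrt (2 * Real.pi))⁻¹ * Real.exp (-(1 / 2) * x ^ 2) := by
  rw [gaussianPDFReal]
  simp only [NNReal.coe_one, mul_one, sub_zero]
  congr 2; ring

lemma integrable_pow_mul_gaussianPDFReal (n : ℕ) :
    Integrable fun x : ℝ => x ^ n * gaussianPDFReal 0 1 x := by
  have h := (integrable_rpow_mul_exp_neg_mul_sq (b := 1 / 2) (by norm_num) (s := n)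
    (by linarith [(Nat.cast_nonneg n : (0 : ℝ) ≤ n)])).const_mul (Real.sqrt (2 * Real.pi))⁻¹
  refine h.congr (.of_forall fun x => ?_)
  simp only [gaussianPDFReal_zero_one, Real.rpow_natCast]
  ring

lemma integrable_gaussianReal_iff {E : Type*} [NormedAddCommGroup E] [NormedSpace ℝ E]
    {f : ℝ → E} :
    Integrable f (gaussianReal 0 1) ↔ Integrable fun x => gaussianPDFReal 0 1 x • f x := by
  rw [gaussianReal_of_var_ne_zero 0 one_ne_zero, integrable_withDensity_iff_integrable_smul'
    (measurable_gaussianPDF 0 1) (.of_forall fun x => gaussianPDF_lt_top)]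
  simp [toReal_gaussianPDF]

lemma integrable_pow_gaussianReal (n : ℕ) :
    Integrable (fun x : ℝ => x ^ n) (gaussianReal 0 1) := by
  rw [integrable_gaussianReal_iff]
  refine (integrable_pow_mul_gaussianPDFReal n).congr (.of_forall fun x => ?_)
  simp [mul_comm]

lemma hasDerivAt_gaussianPDFReal (x : ℝ) :
    HasDerivAt (gaussianPDFReal 0 1) (-(x * gaussianPDFReal 0 1 x)) x := by
  have e : gaussianPDFReal 0 1 =
      fun x => (Real.sqrt (2 * Real.pi))⁻¹ * Real.exp (-(1 / 2) * x ^ 2) :=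
    funext gaussianPDFReal_zero_one
  rw [e]
  have h := (((hasDerivAt_pow 2 x).const_mul (-(1 / 2) : ℝ)).exp).const_mul
    (Real.sqrt (2 * Real.pi))⁻¹
  refine h.congr_deriv ?_
  push_cast
  ring

/-- Integration by parts. -/
lemma integral_pow_add_two_gaussianReal (n : ℕ) :
    ∫ x, x ^ (n + 2) ∂gaussianReal 0 1 = (n + 1) * ∫ x, x ^ n ∂gaussianReal 0 1 := by
  simp only [integral_gaussianReal_eq_integral_smul one_ne_zero, smul_eq_mul]
  have h := integral_mul_deriv_eq_deriv_mul_of_integrable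
    (u := fun x : ℝ => x ^ (n + 1)) (v := gaussianPDFReal 0 1)
    (u' := fun x => (n + 1) * x ^ n) (v' := fun x => -(x * gaussianPDFReal 0 1 x))
    (fun x _ => by simpa using hasDerivAt_pow (n + 1) x) (fun x _ => hasDerivAt_gaussianPDFReal x)
    ((integrable_pow_mul_gaussianPDFReal (n + 2)).neg.congr (.of_forall fun x => by
      simp only [Pi.neg_apply, Pi.mul_apply]; ring))
    (((integrable_pow_mul_gaussianPDFReal n).const_mul (n + 1)).congr (.of_forall fun x => by
      simp only [Pi.mul_apply]; ring))
    (integrable_pow_mul_gaussianPDFReal (n + 1))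
  rw [← neg_inj, ← integral_neg, ← integral_const_mul, ← integral_neg]
  refine Eq.trans ?_ (h.trans ?_)
  · congr 1; ext x; ring
  · rw [← integral_neg]; congr 1; ext x; ring

lemma integral_pow_two_mul_gaussianReal (k : ℕ) :
    ∫ x, x ^ (2 * k) ∂gaussianReal 0 1 = (2 * k).factorial / (2 ^ k * k.factorial) := by
  induction k with
  | zero => simp
  | succ k ih =>
    rw [show 2 * (k + 1) = 2 * k + 2 by ring, integral_pow_add_two_gaussianReal, ih,
      Nat.factorial_succ, Nat.factorial_succ, Nat.factorial_succ]
    push_cast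
    field_simp
    ring

lemma integral_pow_odd_gaussianReal (k : ℕ) :
    ∫ x, x ^ (2 * k + 1) ∂gaussianReal 0 1 = 0 := by
  induction k with
  | zero => simp [integral_id_gaussianReal]
  | succ k ih =>
    rw [show 2 * (k + 1) + 1 = (2 * k + 1) + 2 by ring, integral_pow_add_two_gaussianReal, ih,
      mul_zero]

lemma sum_range_two_mul_of_odd_eq_zero {M : Type*} [AddCommMonoid M] (f : ℕ → M)
    (hf : ∀ k, f (2 * k + 1) = 0) (n : ℕ) :
    ∑ j ∈ Finset.range (2 * n), f j = ∑ k ∈ Finset.range n, f (2 * k) := by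
  induction n with
  | zero => simp
  | succ n ih =>
    rw [show 2 * (n + 1) = 2 * n + 1 + 1 by ring, Finset.sum_range_succ, Finset.sum_range_succ, ih,
      hf, add_zero, Finset.sum_range_succ]

/-- The heat flow is convolution with a (complexly scaled) Gaussian: if `c² = -τ`, then
`e^{-τ D²/2} zᵐ` is the mean of `(z + c u)ᵐ` for a standard real Gaussian `u`. -/
lemma integral_gafBasis_add_mul_gaussianReal {τ c : ℂ} (hc : c ^ 2 = -τ) (m : ℕ) (z : ℂ) :
    ∫ u : ℝ, gafBasis m (z + c * u) ∂gaussianReal 0 1 = heatFlow τ (gafBasis m) z := by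
  set f : ℕ → ℂ := fun j =>
    c ^ j * z ^ (m - j) * m.choose j * ((∫ x, x ^ j ∂gaussianReal 0 1 : ℝ) : ℂ) with hf
  have h1 : ∫ u : ℝ, (z + c * u) ^ m ∂gaussianReal 0 1 = ∑ j ∈ Finset.range (m + 1), f j := by
    have e : ∀ u : ℝ, (z + c * u) ^ m = ∑ j ∈ Finset.range (m + 1),
        (c ^ j * z ^ (m - j) * m.choose j) * ((u ^ j : ℝ) : ℂ) := fun u => by
      rw [add_comm, add_pow]
      refine Finset.sum_congr rfl fun j _ => ?_
      push_cast; ring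
    simp_rw [e]
    rw [integral_finsetSum _ fun j _ => ((integrable_pow_gaussianReal j).ofReal).const_mul _]
    refine Finset.sum_congr rfl fun j _ => ?_
    rw [integral_const_mul, integral_complex_ofReal]
  have h2 : ∑ j ∈ Finset.range (m + 1), f j = ∑ j ∈ Finset.range (2 * (m + 1)), f j := by
    refine Finset.sum_subset (Finset.range_subset_range.2 (by omega)) fun j _ hj => ?_
    rw [Finset.mem_range, not_lt] at hj
    simp [hf, Nat.choose_eq_zero_of_lt (show m < j by omega)]
  have h3 : ∀ k, f (2 * k) = (1 / (k.factorial : ℂ)) * (-τ / 2) ^ k *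
      (m.descFactorial (2 * k) * z ^ (m - 2 * k)) := fun k => by
    simp only [hf]
    rw [integral_pow_two_mul_gaussianReal, pow_mul, hc, Nat.descFactorial_eq_factorial_mul_choose,
      div_pow]
    push_cast
    have : ((2 * k).factorial : ℂ) ≠ 0 := by exact_mod_cast Nat.factorial_ne_zero _
    have : (k.factorial : ℂ) ≠ 0 := by exact_mod_cast Nat.factorial_ne_zero _
    field_simp
  have h4 : heatFlow τ (gafBasis m) z =
      ∑ k ∈ Finset.range (m + 1), heatTerm τ (gafBasis m) z k := by
    refine tsum_eq_sum fun k hk => ?_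
    rw [Finset.mem_range, not_lt] at hk
    rw [heatTerm, iteratedDeriv_gafBasis, Nat.descFactorial_of_lt (by omega)]
    simp
  simp only [gafBasis]
  rw [integral_div, h1, h2, sum_range_two_mul_of_odd_eq_zero f (fun k => by
    simp [hf, integral_pow_odd_gaussianReal]), h4, Finset.sum_div]
  refine Finset.sum_congr rfl fun k _ => ?_
  rw [h3, heatTerm, iteratedDeriv_gafBasis]
  ring

lemma hasSum_gafBasis_mul_gafBasis (z w : ℂ) :
    HasSum (fun m => gafBasis m z * gafBasis m w) (Complex.exp (z * w)) := by
  have h := NormedSpace.expSeries_div_hasSum_exp (z * w)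
  rw [← Complex.exp_eq_exp_ℂ] at h
  refine h.congr_fun fun m => ?_
  rw [gafBasis, gafBasis, div_mul_div_comm, ← mul_pow, ← Complex.ofReal_mul,
    Real.mul_self_sqrt (by positivity), Complex.ofReal_natCast]

lemma hasSum_gafBasis_mul_conj_gafBasis (z w : ℂ) :
    HasSum (fun m => gafBasis m z * conj (gafBasis m w)) (Complex.exp (z * conj w)) :=
  (hasSum_gafBasis_mul_gafBasis z (conj w)).congr_fun fun m => by simp [gafBasis]

/-- The generating function of the Hermite-type polynomials `e^{-τ D²/2} (zᵐ / √m!)`. -/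
lemma hasSum_gafBasis_mul_heatFlow {τ : ℂ} (hτ : ‖τ‖ < 1) (z w : ℂ) :
    HasSum (fun m => gafBasis m z * heatFlow τ (gafBasis m) w)
      (Complex.exp (z * w - τ * z ^ 2 / 2)) := by
  have h := hasSum_heatFlow_planeGAF (a := fun m => gafBasis m z) (A := 1)
    (C := Real.exp (‖z‖ ^ 2 / 2)) (τ := τ) zero_le_one
    (fun m => by simpa using norm_gafBasis_le m z) (by simpa using hτ) w
  convert h using 1
  have hG : planeGAF (fun m => gafBasis m z) = fun w => Complex.exp (z * w) :=
    funext fun w => (hasSum_gafBasis_mul_gafBasis z w).tsum_eq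
  have hs := (NormedSpace.expSeries_div_hasSum_exp (-τ / 2 * z ^ 2)).mul_right (Complex.exp (z * w))
  rw [← Complex.exp_eq_exp_ℂ, ← Complex.exp_add] at hs
  rw [heatFlow, hG, show z * w - τ * z ^ 2 / 2 = -τ / 2 * z ^ 2 + z * w by ring, ← hs.tsum_eq]
  congr 1; ext k
  rw [heatTerm, iteratedDeriv_cexp_const_mul, mul_pow, pow_mul]
  ring

lemma exists_one_lt_sq_mul_lt_one {t : ℝ} (ht : t < 1) : ∃ A : ℝ, 1 < A ∧ A ^ 2 * t < 1 := by
  have hc : Tendsto (fun x : ℝ => x ^ 2 * t) (𝓝[>] 1) (𝓝 (1 ^ 2 * t)) :=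
    ((by fun_prop : Continuous fun x : ℝ => x ^ 2 * t).tendsto 1).mono_left nhdsWithin_le_nhds
  obtain ⟨x, h1, h2⟩ := ((hc.eventually (gt_mem_nhds (by simpa using ht))).and
    self_mem_nhdsWithin).exists
  exact ⟨x, h2, h1⟩

/-- Since `|τ| < 1`, the coefficients `e^{-τ D²/2} (zᵐ / √m!)` decay geometrically in `m`. -/
lemma exists_norm_heatFlow_gafBasis_le {τ : ℂ} (hτ : ‖τ‖ < 1) (w : ℂ) :
    ∃ B C : ℝ, 0 ≤ B ∧ B < 1 ∧ ∀ m, ‖heatFlow τ (gafBasis m) w‖ ≤ C * B ^ m := by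
  obtain ⟨A, hA, hA1⟩ := exists_one_lt_sq_mul_lt_one hτ
  have hA0 : 0 < A := by linarith
  have h := (hasSum_heatFlow_planeGAF (a := fun m => (A : ℂ) ^ m) (A := A) (C := 1) (τ := τ) hA0.le
    (fun m => by simp [abs_of_pos hA0]) hA1 w).summable.norm
  refine ⟨A⁻¹, ∑' m, ‖(A : ℂ) ^ m * heatFlow τ (gafBasis m) w‖, by positivity,
    inv_lt_one_of_one_lt₀ hA, fun m => ?_⟩
  · have := h.le_tsum m fun _ _ => norm_nonneg _
    rw [norm_mul, norm_pow, Complex.norm_real, Real.norm_of_nonneg hA0.le] at this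
    rw [inv_pow, ← div_eq_mul_inv, le_div_iff₀ (by positivity)]
    linarith

lemma add_mul_sq_le {r ρ u : ℝ} (hρ : ρ ^ 2 < 1) :
    (r + ρ * |u|) ^ 2 ≤ (1 + ρ ^ 2) / 2 * u ^ 2 + (r ^ 2 + (r * ρ) ^ 2 / ((1 - ρ ^ 2) / 2)) := by
  have hδ : 0 < (1 - ρ ^ 2) / 2 := by linarith
  have h : 0 ≤ ((1 - ρ ^ 2) / 2 * |u| - r * ρ) ^ 2 / ((1 - ρ ^ 2) / 2) := by positivity
  have e : ((1 - ρ ^ 2) / 2 * |u| - r * ρ) ^ 2 / ((1 - ρ ^ 2) / 2) =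
      (1 - ρ ^ 2) / 2 * |u| ^ 2 - 2 * r * ρ * |u| + (r * ρ) ^ 2 / ((1 - ρ ^ 2) / 2) := by
    have : 1 - ρ ^ 2 ≠ 0 := by linarith
    field_simp; ring
  rw [e] at h
  rw [← sq_abs u]
  nlinarith

lemma integrable_exp_norm_add_mul_sq {c : ℂ} (hc : ‖c‖ ^ 2 < 1) (z : ℂ) :
    Integrable (fun u : ℝ => Real.exp (‖z + c * u‖ ^ 2 / 2)) (gaussianReal 0 1) := by
  rw [integrable_gaussianReal_iff]
  set K := ‖z‖ ^ 2 + (‖z‖ * ‖c‖) ^ 2 / ((1 - ‖c‖ ^ 2) / 2) with hK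
  have hb : 0 < (1 - ‖c‖ ^ 2) / 4 := by linarith
  refine ((integrable_exp_neg_mul_sq hb).const_mul
    ((Real.sqrt (2 * Real.pi))⁻¹ * Real.exp (K / 2))).mono'
    (by simp_rw [gaussianPDFReal_zero_one]; fun_prop) (.of_forall fun u => ?_)
  rw [gaussianPDFReal_zero_one, smul_eq_mul, Real.norm_of_nonneg (by positivity), mul_assoc,
    mul_assoc, ← Real.exp_add, ← Real.exp_add]
  refine mul_le_mul_of_nonneg_left (Real.exp_le_exp.2 ?_) (by positivity)
  have h1 : ‖z + c * u‖ ≤ ‖z‖ + ‖c‖ * |u| := by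
    refine (norm_add_le _ _).trans (by simp)
  have h2 : ‖z + c * u‖ ^ 2 ≤ (‖z‖ + ‖c‖ * |u|) ^ 2 := by gcongr
  have h3 := add_mul_sq_le (r := ‖z‖) (u := u) hc
  rw [← hK] at h3
  linarith

lemma integral_cexp_gaussianReal {τ c : ℂ} (hτ : ‖τ‖ < 1) (hc : c ^ 2 = -τ) (z w : ℂ) :
    ∫ u : ℝ, Complex.exp ((z + c * u) * w - conj τ * (z + c * u) ^ 2 / 2) ∂gaussianReal 0 1 =
      ((Real.sqrt (1 - ‖τ‖ ^ 2))⁻¹ : ℝ) * Complex.exp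
        ((z * w - conj τ * z ^ 2 / 2 - τ * w ^ 2 / 2) / ((1 - ‖τ‖ ^ 2 : ℝ) : ℂ)) := by
  have hD : 0 < 1 - ‖τ‖ ^ 2 := by nlinarith [norm_nonneg τ]
  have hT : conj τ * τ = ((‖τ‖ ^ 2 : ℝ) : ℂ) := by
    rw [Complex.conj_mul']; push_cast; rfl
  set D : ℝ := 1 - ‖τ‖ ^ 2 with hDdef
  have hT' : conj τ * τ = 1 - (D : ℂ) := by rw [hT, hDdef]; push_cast; ring
  have hDC : (D : ℂ) ≠ 0 := by exact_mod_cast hD.ne'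
  rw [integral_gaussianReal_eq_integral_smul one_ne_zero]
  have e : ∀ u : ℝ, gaussianPDFReal 0 1 u •
      Complex.exp ((z + c * u) * w - conj τ * (z + c * u) ^ 2 / 2) =
      (((Real.sqrt (2 * Real.pi))⁻¹ : ℝ) : ℂ) * Complex.exp (((-(D / 2) : ℝ) : ℂ) * (u : ℂ) ^ 2 +
        (c * (w - conj τ * z)) * u + (z * w - conj τ * z ^ 2 / 2)) := fun u => by
    rw [gaussianPDFReal_zero_one, Complex.real_smul, Complex.ofReal_mul, mul_assoc,
      Complex.ofReal_exp, ← Complex.exp_add]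
    congr 2
    push_cast
    have : conj τ * c ^ 2 = -(1 - (D : ℂ)) := by rw [hc, ← hT']; ring
    linear_combination (-(u : ℂ) ^ 2 / 2) * this
  simp_rw [e]
  rw [integral_const_mul, integral_cexp_quadratic
    (by rw [Complex.ofReal_re]; linarith), ← mul_assoc]
  congr 1
  · rw [← Complex.ofReal_neg, ← Complex.ofReal_div, show (1 / 2 : ℂ) = ((1 / 2 : ℝ) : ℂ) by simp,
      ← Complex.ofReal_cpow (by rw [neg_neg]; positivity), ← Complex.ofReal_mul, neg_neg,
      ← Real.sqrt_eq_rpow, show Real.pi / (D / 2) = (2 * Real.pi) / D by field_simp,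
      Real.sqrt_div (by positivity)]
    congr 1
    have := Real.sqrt_pos.2 Real.two_pi_pos
    field_simp
  · congr 1
    have h1 : (c * (w - conj τ * z)) ^ 2 = -τ * (w - conj τ * z) ^ 2 := by rw [mul_pow, hc]
    rw [h1]
    push_cast
    field_simp
    linear_combination (8 * z * w - 4 * z ^ 2 * conj τ) * hT'

/-- Mehler's formula for the Hermite-type polynomials `e^{-τ D²/2} (zᵐ / √m!)`. -/
lemma hasSum_heatFlow_mul_conj_heatFlow {τ : ℂ} (hτ : ‖τ‖ < 1) (z w : ℂ) :
    HasSum (fun m => heatFlow τ (gafBasis m) z * conj (heatFlow τ (gafBasis m) w))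
      (((Real.sqrt (1 - ‖τ‖ ^ 2))⁻¹ : ℝ) * Complex.exp
        ((z * conj w - conj τ * z ^ 2 / 2 - τ * conj w ^ 2 / 2) / ((1 - ‖τ‖ ^ 2 : ℝ) : ℂ))) := by
  obtain ⟨c, hc⟩ : ∃ c : ℂ, c ^ 2 = -τ := IsAlgClosed.exists_pow_nat_eq _ two_pos
  have hcn : ‖c‖ ^ 2 < 1 := by rw [← norm_pow, hc, norm_neg]; exact hτ
  obtain ⟨B, C, hB0, hB1, hB⟩ := exists_norm_heatFlow_gafBasis_le hτ w
  rw [← integral_cexp_gaussianReal hτ hc]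
  have e : ∀ m, heatFlow τ (gafBasis m) z * conj (heatFlow τ (gafBasis m) w) =
      ∫ u : ℝ, gafBasis m (z + c * u) * conj (heatFlow τ (gafBasis m) w) ∂gaussianReal 0 1 :=
    fun m => by rw [integral_mul_const, integral_gafBasis_add_mul_gaussianReal hc]
  simp_rw [e]
  have hmeas : ∀ m, Continuous (gafBasis m) := fun m => by unfold gafBasis; fun_prop
  have hgeo := (summable_geometric_of_lt_one hB0 hB1)
  refine hasSum_integral_of_dominated_convergence
    (fun m u => (C * B ^ m) * Real.exp (‖z + c * u‖ ^ 2 / 2)) (fun m => ?_)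
    (fun m => .of_forall fun u => ?_) (.of_forall fun u => ?_) ?_ (.of_forall fun u => ?_)
  · have := hmeas m
    exact (by fun_prop : Continuous fun u : ℝ => gafBasis m (z + c * u) *
      conj (heatFlow τ (gafBasis m) w)).aestronglyMeasurable
  · rw [norm_mul, RCLike.norm_conj, mul_comm]
    exact mul_le_mul (hB m) (norm_gafBasis_le _ _) (norm_nonneg _) ((norm_nonneg _).trans (hB m))
  · exact (hgeo.mul_left C).mul_right _
  · simp_rw [tsum_mul_right]
    exact (integrable_exp_norm_add_mul_sq hcn z).const_mul _
  · have h := (hasSum_gafBasis_mul_heatFlow hτ (conj (z + c * u)) w).star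
    have e1 : ∀ m, star (gafBasis m (conj (z + c * u)) * heatFlow τ (gafBasis m) w) =
        gafBasis m (z + c * u) * conj (heatFlow τ (gafBasis m) w) := fun m => by
      simp [gafBasis, mul_comm]
    simp_rw [e1] at h
    have e2 : star (Complex.exp (conj (z + c * u) * w - τ * conj (z + c * u) ^ 2 / 2)) =
        Complex.exp ((z + c * u) * conj w - conj τ * (z + c * u) ^ 2 / 2) := by
      rw [← starRingEnd_apply, ← Complex.exp_conj]
      simp [-map_add, Complex.conj_ofNat]
    rwa [e2] at h

/-- The images of the normalised monomials under `V_τ` have the same reproducing kernel as the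
monomials themselves. -/
lemma hasSum_heatV_mul_conj_heatV {τ : ℂ} (hτ : ‖τ‖ < 1) (z w : ℂ) :
    HasSum (fun m => heatV τ (gafBasis m) z * conj (heatV τ (gafBasis m) w))
      (Complex.exp (z * conj w)) := by
  have hD : 0 < 1 - ‖τ‖ ^ 2 := by nlinarith [norm_nonneg τ]
  have hDC : ((1 - ‖τ‖ ^ 2 : ℝ) : ℂ) ≠ 0 := by exact_mod_cast hD.ne'
  have h := (hasSum_heatFlow_mul_conj_heatFlow hτ (z * heatScale τ) (w * heatScale τ)).mul_left
    (((((1 - ‖τ‖ ^ 2) ^ (1 / 4 : ℝ) : ℝ) : ℂ) * Complex.exp (conj τ * z ^ 2 / 2)) *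
      conj ((((1 - ‖τ‖ ^ 2) ^ (1 / 4 : ℝ) : ℝ) : ℂ) * Complex.exp (conj τ * w ^ 2 / 2)))
  have hs : (heatScale τ : ℂ) ^ 2 = ((1 - ‖τ‖ ^ 2 : ℝ) : ℂ) := by
    rw [heatScale, ← Complex.ofReal_pow, Real.sq_sqrt hD.le]
  have hq : (1 - ‖τ‖ ^ 2) ^ (1 / 4 : ℝ) * (1 - ‖τ‖ ^ 2) ^ (1 / 4 : ℝ) *
      (Real.sqrt (1 - ‖τ‖ ^ 2))⁻¹ = 1 := by
    rw [← Real.rpow_add hD, Real.sqrt_eq_rpow, show (1 / 4 + 1 / 4 : ℝ) = 1 / 2 by norm_num]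
    exact mul_inv_cancel₀ (Real.rpow_pos_of_pos hD _).ne'
  replace h := h.congr_fun (g := fun m => heatV τ (gafBasis m) z * conj (heatV τ (gafBasis m) w))
    (fun m => by simp only [heatV, map_mul]; ring)
  refine (congrArg (HasSum _ · _) ?_).mp h
  · have e1 : (z * heatScale τ * conj (w * (heatScale τ : ℂ)) -
        conj τ * (z * heatScale τ) ^ 2 / 2 - τ * conj (w * (heatScale τ : ℂ)) ^ 2 / 2) /
        ((1 - ‖τ‖ ^ 2 : ℝ) : ℂ) = z * conj w - conj τ * z ^ 2 / 2 - τ * conj w ^ 2 / 2 := by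
      rw [div_eq_iff hDC, ← hs, map_mul, Complex.conj_ofReal]
      ring
    rw [e1, map_mul, ← Complex.exp_conj, Complex.conj_ofReal]
    have hqC : (((1 - ‖τ‖ ^ 2) ^ (1 / 4 : ℝ) : ℝ) : ℂ) * (((1 - ‖τ‖ ^ 2) ^ (1 / 4 : ℝ) : ℝ) : ℂ) *
        (((Real.sqrt (1 - ‖τ‖ ^ 2))⁻¹ : ℝ) : ℂ) = 1 := by exact_mod_cast hq
    have e2 : Complex.exp (z * conj w) = Complex.exp (conj τ * z ^ 2 / 2) *
        Complex.exp (conj (conj τ * w ^ 2 / 2)) *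
        Complex.exp (z * conj w - conj τ * z ^ 2 / 2 - τ * conj w ^ 2 / 2) := by
      rw [← Complex.exp_add, ← Complex.exp_add]
      congr 1
      simp [Complex.conj_ofNat]
    rw [e2]
    linear_combination (Complex.exp (conj τ * z ^ 2 / 2) *
        Complex.exp (conj (conj τ * w ^ 2 / 2)) *
        Complex.exp (z * conj w - conj τ * z ^ 2 / 2 - τ * conj w ^ 2 / 2)) * hqC

/-! ### Gaussian series and their finite-dimensional laws -/

lemma measurable_stdComplexGaussian_density :
    Measurable fun z : ℂ => Real.toNNReal (Real.pi⁻¹ * Real.exp (-‖z‖ ^ 2)) := by fun_prop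

lemma integral_stdComplexGaussian {E : Type*} [NormedAddCommGroup E] [NormedSpace ℝ E]
    (f : ℂ → E) :
    ∫ z, f z ∂stdComplexGaussian = ∫ z, (Real.pi⁻¹ * Real.exp (-‖z‖ ^ 2)) • f z := by
  have h : stdComplexGaussian = (volume : Measure ℂ).withDensity
      (fun z => ((Real.toNNReal (Real.pi⁻¹ * Real.exp (-‖z‖ ^ 2)) : ℝ≥0) : ℝ≥0∞)) := rfl
  rw [h, integral_withDensity_eq_integral_smul measurable_stdComplexGaussian_density]
  congr 1; ext z
  rw [NNReal.smul_def, Real.coe_toNNReal _ (by have := Real.pi_pos; positivity)]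

/-- The characteristic function of the standard complex Gaussian distribution. -/
lemma integral_cexp_inner_stdComplexGaussian (w : ℂ) :
    ∫ z : ℂ, Complex.exp ((inner ℝ w z : ℝ) * Complex.I) ∂stdComplexGaussian =
      Complex.exp (-(‖w‖ ^ 2 / 4 : ℝ)) := by
  rw [integral_stdComplexGaussian]
  have h := GaussianFourier.integral_cexp_neg_mul_sq_norm_add (b := 1) (by simp) Complex.I w
  have e : ∀ z : ℂ, (Real.pi⁻¹ * Real.exp (-‖z‖ ^ 2)) •
      Complex.exp ((inner ℝ w z : ℝ) * Complex.I) = ((Real.pi⁻¹ : ℝ) : ℂ) *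
        Complex.exp (-1 * (‖z‖ : ℂ) ^ 2 + Complex.I * (inner ℝ w z : ℝ)) := fun z => by
    rw [Complex.real_smul, Complex.ofReal_mul, mul_assoc, Complex.ofReal_exp, ← Complex.exp_add]
    congr 2
    push_cast; ring
  simp_rw [e]
  rw [integral_const_mul, h, Complex.finrank_real_complex]
  have hp : (Real.pi : ℂ) ≠ 0 := by exact_mod_cast Real.pi_ne_zero
  simp only [Nat.cast_ofNat, div_one, Complex.I_sq, mul_one]
  rw [div_self two_ne_zero, Complex.cpow_one, ← mul_assoc, Complex.ofReal_inv,
    inv_mul_cancel₀ hp, one_mul]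
  congr 1
  push_cast; ring

lemma lintegral_enorm_stdComplexGaussian_lt_top :
    ∫⁻ z, ‖z‖ₑ ∂stdComplexGaussian < ∞ := by
  have hm : Measurable fun z : ℂ => ENNReal.ofReal (Real.pi⁻¹ * Real.exp (-‖z‖ ^ 2)) := by fun_prop
  rw [stdComplexGaussian, lintegral_withDensity_eq_lintegral_mul _ hm (by fun_prop)]
  have hi : Integrable fun z : ℂ => Real.pi⁻¹ * Real.exp (-(1 / 2) * ‖z‖ ^ 2) := by
    have h := (GaussianFourier.integrable_cexp_neg_mul_sq_norm_add (V := ℂ) (b := 1 / 2)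
      (by norm_num) 0 0).norm.const_mul Real.pi⁻¹
    refine h.congr (.of_forall fun z => ?_)
    simp only [Complex.norm_exp]
    congr 2
    rw [zero_mul, add_zero, show (-(1 / 2) * (‖z‖ : ℂ) ^ 2) = ((-(1 / 2) * ‖z‖ ^ 2 : ℝ) : ℂ) by
      push_cast; ring, Complex.ofReal_re]
  refine lt_of_le_of_lt (lintegral_mono fun z => ?_) hi.lintegral_lt_top
  simp only [Pi.mul_apply]
  rw [← ofReal_norm, ← ENNReal.ofReal_mul (by have := Real.pi_pos; positivity), mul_assoc]
  refine ENNReal.ofReal_le_ofReal (mul_le_mul_of_nonneg_left ?_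
    (by have := Real.pi_pos; positivity))
  -- `r ≤ exp (r² / 2)`
  have h1 : ‖z‖ ≤ Real.exp (‖z‖ ^ 2 / 2) := by
    have := pow_div_sqrt_factorial_le_exp ‖z‖ 1
    simpa using this
  calc Real.exp (-‖z‖ ^ 2) * ‖z‖ ≤ Real.exp (-‖z‖ ^ 2) * Real.exp (‖z‖ ^ 2 / 2) := by gcongr
    _ = _ := by rw [← Real.exp_add]; congr 1; ring

section GaussianSeries

variable {Ω : Type*} [MeasurableSpace Ω] {P : Measure Ω} {ξ : ℕ → Ω → ℂ}

/-- Almost surely, a sequence of standard complex Gaussians grows slower than any given geometric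
sequence, because `∑ ‖ξₙ‖ A⁻ⁿ` has finite mean. -/
lemma ae_exists_growth (hlaw : ∀ n, HasLaw (ξ n) stdComplexGaussian P) {A : ℝ} (hA : 1 < A) :
    ∀ᵐ ω ∂P, ∃ C, ∀ n, ‖ξ n ω‖ ≤ C * A ^ n := by
  have hA0 : 0 < A := by linarith
  set q : ℝ≥0∞ := ENNReal.ofReal A⁻¹ with hq
  have hq1 : q < 1 := by
    rw [hq, ENNReal.ofReal_lt_one]; exact inv_lt_one_of_one_lt₀ hA
  have hae : ∀ n, AEMeasurable (fun ω => q ^ n * ‖ξ n ω‖ₑ) P := fun n =>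
    ((hlaw n).aemeasurable.enorm).const_mul _
  have hfin : ∫⁻ ω, ∑' n, q ^ n * ‖ξ n ω‖ₑ ∂P ≠ ∞ := by
    rw [lintegral_tsum hae]
    have e : ∀ n, ∫⁻ ω, q ^ n * ‖ξ n ω‖ₑ ∂P = q ^ n * ∫⁻ z, ‖z‖ₑ ∂stdComplexGaussian := fun n => by
      rw [lintegral_const_mul'' _ (hlaw n).aemeasurable.enorm, ← (hlaw n).map_eq,
        lintegral_map' (by fun_prop) (hlaw n).aemeasurable]
    simp_rw [e]
    rw [ENNReal.tsum_mul_right, ENNReal.tsum_geometric]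
    refine ENNReal.mul_ne_top ?_ lintegral_enorm_stdComplexGaussian_lt_top.ne
    rw [ENNReal.inv_ne_top]
    exact (tsub_pos_of_lt hq1).ne'
  filter_upwards [ae_lt_top' (AEMeasurable.tsum hae) hfin] with ω hω
  refine ⟨(∑' n, q ^ n * ‖ξ n ω‖ₑ).toReal, fun n => ?_⟩
  have h1 := ENNReal.toReal_mono hω.ne (ENNReal.le_tsum (f := fun n => q ^ n * ‖ξ n ω‖ₑ) n)
  rw [ENNReal.toReal_mul, toReal_enorm, ENNReal.toReal_pow, hq,
    ENNReal.toReal_ofReal (by positivity), inv_pow, inv_mul_le_iff₀ (by positivity)] at h1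
  linarith

/-- An almost surely convergent series `∑ Re (conj (bₘ) ξₘ)` is a centred real Gaussian of variance
`(∑ |bₘ|²) / 2`, stated in terms of its characteristic function at `1`. -/
lemma integral_cexp_of_hasSum_inner [IsProbabilityMeasure P] (hindep : iIndepFun ξ P)
    (hlaw : ∀ n, HasLaw (ξ n) stdComplexGaussian P) {b : ℕ → ℂ} {Q : ℝ}
    (hb : HasSum (fun m => ‖b m‖ ^ 2) Q) {X : Ω → ℝ}
    (hX : ∀ᵐ ω ∂P, HasSum (fun m => (inner ℝ (b m) (ξ m ω) : ℝ)) (X ω)) :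
    ∫ ω, Complex.exp (X ω * Complex.I) ∂P = Complex.exp (-(Q / 4 : ℝ)) := by
  have hpart : ∀ N, ∫ ω, Complex.exp ((∑ m ∈ Finset.range N, (inner ℝ (b m) (ξ m ω) : ℝ) : ℝ) *
      Complex.I) ∂P = Complex.exp (-((∑ m ∈ Finset.range N, ‖b m‖ ^ 2) / 4 : ℝ)) := fun N => by
    have hind := hindep.precomp (g := fun i : Fin N => (i : ℕ)) Fin.val_injective
    have h := hind.integral_fun_prod_comp (f := fun (i : Fin N) z =>
      Complex.exp ((inner ℝ (b i) z : ℝ) * Complex.I)) (fun i => (hlaw i).aemeasurable)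
      (fun i => (by fun_prop : Continuous fun z : ℂ =>
        Complex.exp ((inner ℝ (b i) z : ℝ) * Complex.I)).aestronglyMeasurable)
    have e : ∀ i : Fin N, ∫ ω, Complex.exp ((inner ℝ (b i) (ξ i ω) : ℝ) * Complex.I) ∂P =
        Complex.exp (-(‖b i‖ ^ 2 / 4 : ℝ)) := fun i => by
      rw [← integral_cexp_inner_stdComplexGaussian, ← (hlaw i).map_eq,
        integral_map (hlaw i).aemeasurable (by fun_prop : Continuous fun z : ℂ =>
        Complex.exp ((inner ℝ (b i) z : ℝ) * Complex.I)).aestronglyMeasurable]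
    simp_rw [e] at h
    rw [← Complex.exp_sum] at h
    simp_rw [← Complex.exp_sum] at h
    have e1 : ∀ ω, Complex.exp ((∑ m ∈ Finset.range N, (inner ℝ (b m) (ξ m ω) : ℝ) : ℝ) *
        Complex.I) = Complex.exp (∑ i : Fin N, (inner ℝ (b i) (ξ i ω) : ℝ) * Complex.I) :=
      fun ω => by rw [← Finset.sum_mul, ← Complex.ofReal_sum, Finset.sum_range]
    simp_rw [e1]
    refine h.trans (congrArg _ ?_)
    rw [Finset.sum_range, Finset.sum_div]; push_cast; rw [Finset.sum_neg_distrib]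
  have hlim : Tendsto (fun N => ∫ ω, Complex.exp
      ((∑ m ∈ Finset.range N, (inner ℝ (b m) (ξ m ω) : ℝ) : ℝ) * Complex.I) ∂P) atTop
      (𝓝 (∫ ω, Complex.exp (X ω * Complex.I) ∂P)) := by
    refine tendsto_integral_of_dominated_convergence (fun _ => 1) (fun N => ?_)
      (integrable_const _) (fun N => .of_forall fun ω => ?_) ?_
    · have : ∀ m, AEMeasurable (ξ m) P := fun m => (hlaw m).aemeasurable
      have h2 : AEMeasurable (fun ω => ∑ m ∈ Finset.range N, (inner ℝ (b m) (ξ m ω) : ℝ)) P :=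
        Finset.aemeasurable_fun_sum _ fun m _ => (this m).const_inner
      exact (by fun_prop : Continuous fun x : ℝ => Complex.exp (x * Complex.I)).measurable
        |>.comp_aemeasurable h2 |>.aestronglyMeasurable
    · rw [Complex.norm_exp_ofReal_mul_I]
    · filter_upwards [hX] with ω hω
      exact ((by fun_prop : Continuous fun x : ℝ => Complex.exp (x * Complex.I)).tendsto _).comp
        hω.tendsto_sum_nat
  refine tendsto_nhds_unique hlim ?_
  simp_rw [hpart]
  exact ((by fun_prop : Continuous fun x : ℝ => Complex.exp (-(x / 4 : ℝ))).tendsto _).comp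
    hb.tendsto_sum_nat

lemma exists_forall_eq_sum_inner {ι : Type*} [Fintype ι] [DecidableEq ι]
    (L : StrongDual ℝ (ι → ℂ)) : ∃ c : ι → ℂ, ∀ v, L v = ∑ i, (inner ℝ (c i) (v i) : ℝ) := by
  refine ⟨fun i => (InnerProductSpace.toDual ℝ ℂ).symm
    (L.comp (ContinuousLinearMap.single ℝ (fun _ : ι => ℂ) i)), fun v => ?_⟩
  simp only [InnerProductSpace.toDual_symm_apply, ContinuousLinearMap.comp_apply,
    ContinuousLinearMap.single_apply]
  rw [← map_sum, Finset.univ_sum_single]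

/-- Two Gaussian series with the same reproducing kernel have the same finite-dimensional
distributions: their joint characteristic functions are determined by the kernel. -/
lemma map_eq_map_of_hasSum_of_kernel_eq [IsProbabilityMeasure P] (hindep : iIndepFun ξ P)
    (hlaw : ∀ n, HasLaw (ξ n) stdComplexGaussian P) {ι : Type*} [Fintype ι]
    {φ ψ : ℕ → ι → ℂ} {K : ι → ι → ℂ}
    (hφ : ∀ i j, HasSum (fun m => φ m i * conj (φ m j)) (K i j))
    (hψ : ∀ i j, HasSum (fun m => ψ m i * conj (ψ m j)) (K i j))
    {X Y : Ω → ι → ℂ} (hXm : AEMeasurable X P) (hYm : AEMeasurable Y P)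
    (hX : ∀ᵐ ω ∂P, ∀ i, HasSum (fun m => ξ m ω * φ m i) (X ω i))
    (hY : ∀ᵐ ω ∂P, ∀ i, HasSum (fun m => ξ m ω * ψ m i) (Y ω i)) :
    P.map X = P.map Y := by
  classical
  have hprobX := Measure.isProbabilityMeasure_map hXm (μ := P)
  have hprobY := Measure.isProbabilityMeasure_map hYm (μ := P)
  refine Measure.ext_of_charFunDual (funext fun L => ?_)
  obtain ⟨c, hc⟩ := exists_forall_eq_sum_inner L
  have key : ∀ {χ : ℕ → ι → ℂ} {Z : Ω → ι → ℂ},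
      (∀ i j, HasSum (fun m => χ m i * conj (χ m j)) (K i j)) → AEMeasurable Z P →
      (∀ᵐ ω ∂P, ∀ i, HasSum (fun m => ξ m ω * χ m i) (Z ω i)) →
      charFunDual (P.map Z) L =
        Complex.exp (-((∑ i, ∑ j, (conj (c i) * c j * K i j)).re / 4 : ℝ)) := by
    intro χ Z hχ hZm hZ
    rw [charFunDual_apply, integral_map hZm (by fun_prop)]
    refine integral_cexp_of_hasSum_inner hindep hlaw (b := fun m => ∑ i, c i * conj (χ m i)) ?_ ?_
    · have h1 : HasSum (fun m => ∑ i, ∑ j, conj (c i) * c j * (χ m i * conj (χ m j)))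
          (∑ i, ∑ j, (conj (c i) * c j * K i j)) :=
        hasSum_sum fun i _ => hasSum_sum fun j _ => (hχ i j).mul_left _
      refine (Complex.hasSum_re h1).congr_fun fun m => ?_
      have h2 : ∑ i, ∑ j, conj (c i) * c j * (χ m i * conj (χ m j)) =
          conj (∑ i, c i * conj (χ m i)) * ∑ i, c i * conj (χ m i) := by
        rw [map_sum, Finset.sum_mul_sum]
        refine Finset.sum_congr rfl fun i _ => Finset.sum_congr rfl fun j _ => ?_
        simp only [map_mul, Complex.conj_conj]; ring
      rw [h2, Complex.conj_mul', ← Complex.ofReal_pow, Complex.ofReal_re]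
    · filter_upwards [hZ] with ω hω
      rw [hc]
      have h1 : HasSum (fun m => ∑ i, (inner ℝ (c i) (ξ m ω * χ m i) : ℝ))
          (∑ i, (inner ℝ (c i) (Z ω i) : ℝ)) :=
        hasSum_sum fun i _ => (innerSL ℝ (c i)).hasSum (hω i)
      refine h1.congr_fun fun m => ?_
      rw [sum_inner]
      refine Finset.sum_congr rfl fun i _ => ?_
      simp only [Complex.inner, map_mul, Complex.conj_conj]
      congr 1; ring
  rw [key hφ hXm hX, key hψ hYm hY]

end GaussianSeries

/-! ### The Borel `σ`-algebra of the space of entire functions -/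

instance : SecondCountableTopology EntireFunction :=
  TopologicalSpace.Subtype.secondCountableTopology (α := C(ℂ, ℂ)) {f | Differentiable ℂ f}

instance : T2Space EntireFunction :=
  inferInstanceAs (T2Space {f : C(ℂ, ℂ) // Differentiable ℂ f})

/-- A continuous function is positive on a compact set iff it is bounded below by some `1 / n` on
a countable dense subset. -/
lemma measurableSet_forall_mem_pos {α : Type*} [MeasurableSpace α] {K : Set ℂ} (hK : IsCompact K)
    {g : α → ℂ → ℝ≥0∞} (hg : ∀ a, Continuous (g a)) (hm : ∀ z, Measurable fun a => g a z) :
    MeasurableSet {a | ∀ z ∈ K, 0 < g a z} := by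
  obtain ⟨D, hDc, hDd⟩ := TopologicalSpace.exists_countable_dense K
  have e : {a | ∀ z ∈ K, 0 < g a z} = ⋃ n : ℕ, ⋂ z ∈ D, {a | (n : ℝ≥0∞)⁻¹ ≤ g a z} := by
    ext a
    simp only [Set.mem_ofPred_eq, Set.mem_iUnion, Set.mem_iInter]
    constructor
    · intro h
      obtain rfl | hne := K.eq_empty_or_nonempty
      · exact ⟨0, fun z _ => (Set.notMem_empty _ z.2).elim⟩
      obtain ⟨z₀, hz₀, hmin⟩ := hK.exists_isMinOn hne (hg a).continuousOn
      obtain ⟨n, hn⟩ := ENNReal.exists_inv_nat_lt (h z₀ hz₀).ne'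
      exact ⟨n, fun z _ => hn.le.trans (hmin z.2)⟩
    · rintro ⟨n, hn⟩ z hz
      have hcl : IsClosed {z : K | (n : ℝ≥0∞)⁻¹ ≤ g a z} :=
        isClosed_le continuous_const ((hg a).comp continuous_subtype_val)
      have hsub : (Set.univ : Set K) ⊆ {z : K | (n : ℝ≥0∞)⁻¹ ≤ g a z} := by
        rw [← hDd.closure_eq]
        exact hcl.closure_subset_iff.2 fun z hz => hn z hz
      exact lt_of_lt_of_le (ENNReal.inv_pos.2 (ENNReal.natCast_ne_top n))
        (hsub (Set.mem_univ ⟨z, hz⟩))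
  rw [e]
  exact .iUnion fun n => .biInter hDc fun z _ => measurableSet_le measurable_const (hm z)

/-- Evaluation of entire functions along a dense sequence of points. -/
def evalDenseSeq (F : EntireFunction) (n : ℕ) : ℂ := F.1 (TopologicalSpace.denseSeq ℂ n)

lemma continuous_entire_eval (z : ℂ) : Continuous fun F : EntireFunction => F.1 z :=
  (continuous_eval_const (F := C(ℂ, ℂ)) z).comp continuous_subtype_val

/-- The Borel `σ`-algebra of locally uniform convergence is generated by the evaluations along a
dense sequence. -/
lemma borel_entireFunction_eq_comap :
    borel EntireFunction = MeasurableSpace.comap evalDenseSeq inferInstance := by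
  apply le_antisymm
  · have hsub : (inferInstance : TopologicalSpace EntireFunction) = TopologicalSpace.generateFrom
        ((fun s => (Subtype.val : EntireFunction → C(ℂ, ℂ)) ⁻¹' s) ''
          Set.image2 (fun K U => {f : C(ℂ, ℂ) | Set.MapsTo f K U}) {K | IsCompact K}
            {t | IsOpen t}) := by
      rw [← induced_generateFrom_eq, ← ContinuousMap.compactOpen_eq]
      rfl
    rw [borel_eq_generateFrom_of_subbasis hsub]
    refine MeasurableSpace.generateFrom_le ?_
    rintro _ ⟨_, ⟨K, hK, U, (hU : IsOpen U), rfl⟩, rfl⟩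
    let _ : MeasurableSpace EntireFunction := MeasurableSpace.comap evalDenseSeq inferInstance
    have hseq : ∀ n, Measurable fun F : EntireFunction => F.1 (TopologicalSpace.denseSeq ℂ n) :=
      fun n => (measurable_pi_apply n).comp (comap_measurable evalDenseSeq)
    have hev : ∀ z, Measurable fun F : EntireFunction => F.1 z := fun z => by
      obtain ⟨u, hu, hlim⟩ := mem_closure_iff_seq_limit.1
        (TopologicalSpace.denseRange_denseSeq ℂ z)
      refine measurable_of_tendsto_metrizable (f := fun k (F : EntireFunction) => F.1 (u k))
        (fun k => ?_) (tendsto_pi_nhds.2 fun F => (F.1.continuous.tendsto z).comp hlim)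
      obtain ⟨n, hn⟩ := hu k
      rw [← hn]; exact hseq n
    have h := measurableSet_forall_mem_pos (α := EntireFunction) hK
      (g := fun F z => Metric.infEDist (F.1 z) Uᶜ)
      (fun F => Metric.continuous_infEDist.comp F.1.continuous)
      (fun z => measurable_infEDist.comp (hev z))
    refine (congrArg MeasurableSet (Set.ext fun F => ?_)).mp h
    change (∀ z ∈ K, 0 < Metric.infEDist (F.1 z) Uᶜ) ↔ ∀ z ∈ K, F.1 z ∈ U
    refine forall₂_congr fun z _ => ?_
    rw [pos_iff_ne_zero, Ne, ← Metric.mem_iff_infEDist_zero_of_closed hU.isClosed_compl]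
    simp
  · rw [← measurable_iff_comap_le, measurable_pi_iff]
    exact fun n => (continuous_entire_eval _).borel_measurable

lemma measurable_evalDenseSeq : Measurable evalDenseSeq :=
  measurable_pi_iff.2 fun _ => (continuous_entire_eval _).measurable

lemma measurableSet_entireFunction_iff {s : Set EntireFunction} :
    MeasurableSet s ↔ ∃ t, MeasurableSet t ∧ evalDenseSeq ⁻¹' t = s := by
  change MeasurableSet[borel EntireFunction] s ↔ _
  rw [borel_entireFunction_eq_comap]
  rfl

section Law

variable {Ω : Type*} [MeasurableSpace Ω] {P : Measure Ω}

lemma aemeasurable_entireFunction_of_eval {X : Ω → EntireFunction}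
    (hX : ∀ z, AEMeasurable (fun ω => (X ω).1 z) P) : AEMeasurable X P := by
  have h : AEMeasurable (fun ω => evalDenseSeq (X ω)) P := aemeasurable_pi_iff.2 fun n => hX _
  obtain ⟨N, hN, hNm, hN0⟩ := exists_measurable_superset_of_null (ae_iff.1 h.ae_eq_mk)
  -- on the null set `N` the modification need not come from an entire function
  classical
  refine ⟨fun ω => if ω ∈ N then toEntire 0 else X ω, ?_, ?_⟩
  · intro s hs
    obtain ⟨t, ht, rfl⟩ := measurableSet_entireFunction_iff.1 hs
    have hm : Measurable fun ω => if ω ∈ N then evalDenseSeq (toEntire 0) else h.mk _ ω :=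
      Measurable.ite hNm measurable_const h.measurable_mk
    convert hm ht using 1
    ext ω
    by_cases hω : ω ∈ N
    · simp [hω]
    · have : evalDenseSeq (X ω) = h.mk _ ω := by
        by_contra hne
        exact hω (hN hne)
      simp [hω, this]
  · have : ∀ᵐ ω ∂P, ω ∉ N := measure_eq_zero_iff_ae_notMem.1 hN0
    filter_upwards [this] with ω hω
    simp [hω]

/-- Random entire functions with the same finite-dimensional distributions have the same law. -/
lemma identDistrib_entireFunction_of_eval [IsFiniteMeasure P] {X Y : Ω → EntireFunction}
    (hX : ∀ z, AEMeasurable (fun ω => (X ω).1 z) P)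
    (hY : ∀ z, AEMeasurable (fun ω => (Y ω).1 z) P)
    (h : ∀ (I : Finset ℕ) (d : I → ℂ),
      P.map (fun ω i => (X ω).1 (d i)) = P.map (fun ω i => (Y ω).1 (d i))) :
    IdentDistrib X Y P P := by
  have hXm := aemeasurable_entireFunction_of_eval hX
  have hYm := aemeasurable_entireFunction_of_eval hY
  refine ⟨hXm, hYm, Measure.ext fun s hs => ?_⟩
  have hlaw : P.map (fun ω => evalDenseSeq (X ω)) = P.map (fun ω => evalDenseSeq (Y ω)) :=
    (map_eq_iff_forall_finset_map_restrict_eq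
      (X := fun n ω => evalDenseSeq (X ω) n) (Y := fun n ω => evalDenseSeq (Y ω) n)
      (measurable_evalDenseSeq.comp_aemeasurable hXm)
      (measurable_evalDenseSeq.comp_aemeasurable hYm)).2
      fun I => h I fun i => TopologicalSpace.denseSeq ℂ i
  obtain ⟨t, ht, rfl⟩ := measurableSet_entireFunction_iff.1 hs
  rw [← Measure.map_apply measurable_evalDenseSeq ht,
    ← Measure.map_apply measurable_evalDenseSeq ht,
    AEMeasurable.map_map_of_aemeasurable measurable_evalDenseSeq.aemeasurable hXm,
    AEMeasurable.map_map_of_aemeasurable measurable_evalDenseSeq.aemeasurable hYm]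
  exact congrArg (· t) hlaw

end Law

/-! ### Measurability of the collection of zeros -/

/-- A countable family of closed discs which contains a neighbourhood basis of every point. -/
def basicDisc (i : ℕ × ℕ) : Set ℂ :=
  Metric.closedBall (TopologicalSpace.denseSeq ℂ i.1) (1 / (i.2 + 1 : ℝ))

lemma isCompact_basicDisc (i : ℕ × ℕ) : IsCompact (basicDisc i) := isCompact_closedBall _ _

lemma exists_mem_basicDisc_subset {z : ℂ} {V : Set ℂ} (hV : IsOpen V) (hz : z ∈ V) :
    ∃ i, z ∈ basicDisc i ∧ basicDisc i ⊆ V := by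
  obtain ⟨ε, hε, hball⟩ := Metric.isOpen_iff.1 hV z hz
  obtain ⟨n, hn⟩ := exists_nat_one_div_lt (half_pos hε)
  have hn0 : (0 : ℝ) < 1 / (n + 1) := by positivity
  obtain ⟨k, hk⟩ := (TopologicalSpace.denseRange_denseSeq ℂ).exists_dist_lt z hn0
  refine ⟨(k, n), Metric.mem_closedBall.2 hk.le, fun w hw => hball ?_⟩
  have h1 : dist w (TopologicalSpace.denseSeq ℂ k) ≤ 1 / (n + 1) := Metric.mem_closedBall.1 hw
  rw [Metric.mem_ball]
  have h2 := dist_triangle w (TopologicalSpace.denseSeq ℂ k) z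
  rw [dist_comm z] at hk
  linarith

/-- The number of points of `S` in an open set is the largest number of pairwise disjoint basic
discs inside the open set which all meet `S`. -/
lemma encard_inter_eq_iSup (S : Set ℂ) {U : Set ℂ} (hU : IsOpen U) :
    open Classical in
    (((S ∩ U).encard : ℕ∞) : ℝ≥0∞) =
      ⨆ T : {T : Finset (ℕ × ℕ) // (T : Set (ℕ × ℕ)).PairwiseDisjoint basicDisc ∧
        ∀ i ∈ T, basicDisc i ⊆ U},
        ∑ i ∈ T.1, if (S ∩ basicDisc i).Nonempty then (1 : ℝ≥0∞) else 0 := by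
  classical
  apply le_antisymm
  · refine ENNReal.le_of_forall_nnreal_lt fun r hr => ?_
    obtain ⟨n, hrn, hn⟩ : ∃ n : ℕ, (r : ℝ≥0∞) ≤ n ∧ (n : ℕ∞) ≤ (S ∩ U).encard := by
      by_cases htop : (S ∩ U).encard = ⊤
      · obtain ⟨n, hn⟩ := exists_nat_ge r
        exact ⟨n, by exact_mod_cast hn, by rw [htop]; exact le_top⟩
      · lift (S ∩ U).encard to ℕ using htop with n
        exact ⟨n, by simpa using hr.le, le_rfl⟩
    obtain ⟨t, htS, htn⟩ := Set.exists_subset_encard_eq hn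
    have htfin : t.Finite := Set.finite_of_encard_eq_coe htn
    obtain ⟨V, hV, hVd⟩ := htfin.t2_separation
    have hex : ∀ z : ℂ, ∃ i, z ∈ t → z ∈ basicDisc i ∧ basicDisc i ⊆ V z ∩ U := fun z => by
      by_cases hz : z ∈ t
      · obtain ⟨i, hi⟩ := exists_mem_basicDisc_subset ((hV z).2.inter hU)
          ⟨(hV z).1, (htS hz).2⟩
        exact ⟨i, fun _ => hi⟩
      · exact ⟨(0, 0), fun h => (hz h).elim⟩
    choose i hi using hex
    have hdisj : ∀ z ∈ t, ∀ w ∈ t, z ≠ w → Disjoint (basicDisc (i z)) (basicDisc (i w)) :=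
      fun z hz w hw hzw => (hVd hz hw hzw).mono ((hi z hz).2.trans Set.inter_subset_left)
        ((hi w hw).2.trans Set.inter_subset_left)
    have hinj : Set.InjOn i t := fun z hz w hw hzw => by
      by_contra hne
      exact Set.disjoint_left.1 (hdisj z hz w hw hne) (hi z hz).1 (hzw ▸ (hi z hz).1)
    let T : Finset (ℕ × ℕ) := htfin.toFinset.image i
    have hT : (T : Set (ℕ × ℕ)).PairwiseDisjoint basicDisc ∧ ∀ j ∈ T, basicDisc j ⊆ U := by
      constructor
      · intro a ha b hb hab
        obtain ⟨z, hz, rfl⟩ := Finset.mem_image.1 (Finset.mem_coe.1 ha)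
        obtain ⟨w, hw, rfl⟩ := Finset.mem_image.1 (Finset.mem_coe.1 hb)
        exact hdisj z (htfin.mem_toFinset.1 hz) w (htfin.mem_toFinset.1 hw)
          fun h => hab (by rw [h])
      · intro j hj
        obtain ⟨z, hz, rfl⟩ := Finset.mem_image.1 hj
        exact (hi z (htfin.mem_toFinset.1 hz)).2.trans Set.inter_subset_right
    refine hrn.trans (le_trans (le_of_eq ?_) (le_iSup _ ⟨T, hT⟩))
    have hone : ∀ j ∈ T, (if (S ∩ basicDisc j).Nonempty then (1 : ℝ≥0∞) else 0) = 1 := by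
      intro j hj
      obtain ⟨z, hz, rfl⟩ := Finset.mem_image.1 hj
      rw [htfin.mem_toFinset] at hz
      rw [if_pos ⟨z, (htS hz).1, (hi z hz).1⟩]
    rw [Finset.sum_congr rfl hone, Finset.sum_const, nsmul_one,
      Finset.card_image_of_injOn (by simpa using hinj)]
    rw [htfin.encard_eq_coe_toFinset_card] at htn
    exact_mod_cast htn.symm
  · refine iSup_le fun ⟨T, hTd, hTU⟩ => ?_
    rw [Finset.sum_ite, Finset.sum_const_zero, add_zero, Finset.sum_const, nsmul_one]
    set T' := T.filter fun i => (S ∩ basicDisc i).Nonempty with hT'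
    have hex : ∀ i, ∃ z, i ∈ T' → z ∈ S ∩ basicDisc i := fun i => by
      by_cases hi : i ∈ T'
      · obtain ⟨z, hz⟩ := (Finset.mem_filter.1 hi).2
        exact ⟨z, fun _ => hz⟩
      · exact ⟨0, fun h => (hi h).elim⟩
    choose z hz using hex
    have hinj : Set.InjOn z T' := fun i hi j hj hij => by
      by_contra hne
      refine Set.disjoint_left.1 (hTd (Finset.mem_filter.1 hi).1 (Finset.mem_filter.1 hj).1 hne)
        (hz i hi).2 ?_
      rw [hij]; exact (hz j hj).2
    have hle : ((T'.card : ℕ) : ℕ∞) ≤ (S ∩ U).encard := by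
      rw [← Set.encard_coe_eq_coe_finsetCard, ← hinj.encard_image]
      refine Set.encard_le_encard ?_
      rintro _ ⟨i, hi, rfl⟩
      exact ⟨(hz i hi).1, hTU i (Finset.mem_filter.1 hi).1 (hz i hi).2⟩
    exact_mod_cast ENat.toENNReal_le.2 hle

section RandomSets

variable {α : Type*} [MeasurableSpace α] {S : α → Set ℂ}

lemma measurable_count_inter_open (hS : ∀ a, IsClosed (S a))
    (hhit : ∀ K, IsCompact K → MeasurableSet {a | (S a ∩ K).Nonempty}) {U : Set ℂ}
    (hU : IsOpen U) : Measurable fun a => Measure.count (S a ∩ U) := by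
  classical
  have e : ∀ a, Measure.count (S a ∩ U) = _ := fun a =>
    (Measure.count_apply ((hS a).measurableSet.inter hU.measurableSet)).trans
      (encard_inter_eq_iSup (S a) hU)
  simp_rw [e]
  refine Measurable.iSup fun T => Finset.measurable_fun_sum _ fun i _ => ?_
  exact Measurable.ite (hhit _ (isCompact_basicDisc i)) measurable_const measurable_const

/-- The counting measure of a locally finite random closed set is a random measure as soon as the
events that the set meets a given compact set are measurable. -/
lemma measurable_count_restrict (hS : ∀ a, IsClosed (S a))
    (hhit : ∀ K, IsCompact K → MeasurableSet {a | (S a ∩ K).Nonempty})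
    (hfin : ∀ a K, IsCompact K → (S a ∩ K).Finite) :
    Measurable fun a => Measure.count.restrict (S a) := by
  have hball : ∀ n : ℕ, Measurable fun a =>
      (Measure.count.restrict (S a ∩ Metric.ball 0 n) : Measure ℂ) := fun n => by
    have : ∀ a, IsFiniteMeasure (Measure.count.restrict (S a ∩ Metric.ball 0 n) : Measure ℂ) :=
      fun a => by
        refine ⟨?_⟩
        rw [Measure.restrict_apply_univ]
        exact Measure.count_apply_lt_top.2 ((hfin a _ (isCompact_closedBall 0 n)).subset
          (Set.inter_subset_inter_right _ Metric.ball_subset_closedBall))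
    refine Measurable.measure_of_isPiSystem BorelSpace.measurable_eq isPiSystem_isOpen
      (fun U (hU : IsOpen U) => ?_) ?_
    · simp_rw [Measure.restrict_apply hU.measurableSet, Set.inter_comm U,
        Set.inter_assoc]
      exact measurable_count_inter_open hS hhit (Metric.isOpen_ball.inter hU)
    · simp_rw [Measure.restrict_apply_univ]
      exact measurable_count_inter_open hS hhit Metric.isOpen_ball
  refine Measure.measurable_of_measurable_coe _ fun s hs => ?_
  have e : ∀ a, Measure.count.restrict (S a) s =
      ⨆ n : ℕ, Measure.count.restrict (S a ∩ Metric.ball 0 n) s := fun a => by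
    simp_rw [Measure.restrict_apply hs]
    rw [← Monotone.measure_iUnion]
    · rw [← Set.inter_iUnion, ← Set.inter_iUnion, Metric.iUnion_ball_nat, Set.inter_univ]
    · intro m n hmn
      exact Set.inter_subset_inter_right _ (Set.inter_subset_inter_right _
        (Metric.ball_subset_ball (by exact_mod_cast hmn)))
  simp_rw [e]
  exact Measurable.iSup fun n => (Measure.measurable_coe hs).comp (hball n)

end RandomSets

lemma measurable_iteratedDeriv_entire (j : ℕ) (z : ℂ) :
    Measurable fun F : EntireFunction => iteratedDeriv j F.1 z := by
  induction j generalizing z with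
  | zero => simpa using (continuous_entire_eval z).measurable
  | succ j ih =>
    have hx : Tendsto (fun n : ℕ => z + ((n : ℂ) + 1)⁻¹) atTop (𝓝[≠] z) := by
      refine tendsto_nhdsWithin_iff.2 ⟨?_, .of_forall fun n => ?_⟩
      · have h : Tendsto (fun n : ℕ => ((n : ℂ) + 1)⁻¹) atTop (𝓝 0) := by
          simpa using tendsto_one_div_add_atTop_nhds_zero_nat (𝕜 := ℂ)
        simpa using h.const_add z
      · simp [Nat.cast_add_one_ne_zero]
    refine measurable_of_tendsto_metrizable (f := fun (n : ℕ) (F : EntireFunction) =>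
      slope (iteratedDeriv j F.1) z (z + ((n : ℂ) + 1)⁻¹)) (fun n => ?_)
      (tendsto_pi_nhds.2 fun F => ?_)
    · simp only [slope_def_field]
      exact ((ih _).sub (ih z)).div_const _
    · have hd : DifferentiableAt ℂ (iteratedDeriv j F.1) z :=
        (F.2.contDiff (n := ⊤)).differentiable_iteratedDeriv j (WithTop.coe_lt_top _) z
      rw [iteratedDeriv_succ]
      exact (hasDerivAt_iff_tendsto_slope.1 hd.hasDerivAt).comp hx

lemma continuous_iteratedDeriv_entire (j : ℕ) (F : EntireFunction) :
    Continuous (iteratedDeriv j F.1) :=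
  (F.2.contDiff (n := ⊤)).continuous_iteratedDeriv j le_top

/-- The set of zeros of multiplicity at least `m`. -/
def zerosOfOrder (m : ℕ) (F : ℂ → ℂ) : Set ℂ := {z | (m : ℕ∞) ≤ analyticOrderAt F z}

lemma mem_zerosOfOrder_iff {m : ℕ} {F : EntireFunction} {z : ℂ} :
    z ∈ zerosOfOrder m F.1 ↔ ∀ j < m, iteratedDeriv j F.1 z = 0 :=
  natCast_le_analyticOrderAt_iff_iteratedDeriv_eq_zero (F.2.analyticAt z)

lemma isClosed_zerosOfOrder (m : ℕ) (F : EntireFunction) : IsClosed (zerosOfOrder m F.1) := by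
  have : zerosOfOrder m F.1 = ⋂ j, ⋂ _ : j < m, {z | iteratedDeriv j F.1 z = 0} := by
    ext z; rw [mem_zerosOfOrder_iff]; simp
  rw [this]
  exact isClosed_iInter fun j => isClosed_iInter fun _ =>
    isClosed_eq (continuous_iteratedDeriv_entire j F) continuous_const

lemma measurableSet_zerosOfOrder_inter_nonempty (m : ℕ) {K : Set ℂ} (hK : IsCompact K) :
    MeasurableSet {F : EntireFunction | (zerosOfOrder m F.1 ∩ K).Nonempty} := by
  have h := (measurableSet_forall_mem_pos (α := EntireFunction) hK
    (g := fun F z => ∑ j ∈ Finset.range m, ‖iteratedDeriv j F.1 z‖ₑ)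
    (fun F => continuous_finsetSum _ fun j _ => (continuous_iteratedDeriv_entire j F).enorm)
    (fun z => Finset.measurable_fun_sum _ fun j _ =>
      (measurable_iteratedDeriv_entire j z).enorm)).compl
  refine (congrArg MeasurableSet (Set.ext fun F => ?_)).mp h
  simp only [Set.mem_compl_iff, Set.mem_ofPred_eq, not_forall, Set.Nonempty, Set.mem_inter_iff,
    mem_zerosOfOrder_iff]
  refine exists_congr fun z => ?_
  rw [exists_prop, and_comm, not_lt, nonpos_iff_eq_zero, Finset.sum_eq_zero_iff]
  simp

lemma finite_zerosOfOrder_inter {m : ℕ} (hm : m ≠ 0) {F : EntireFunction} (hF : F ≠ toEntire 0)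
    {K : Set ℂ} (hK : IsCompact K) : (zerosOfOrder m F.1 ∩ K).Finite := by
  by_contra hinf
  obtain ⟨z, _, hz⟩ := Set.Infinite.exists_accPt_of_subset_isCompact hinf hK Set.inter_subset_right
  have hfreq : ∃ᶠ w in 𝓝[≠] z, F.1 w = 0 := by
    refine ((accPt_iff_frequently_nhdsNE.1 hz).mono fun w hw => ?_)
    simpa using mem_zerosOfOrder_iff.1 hw.1 0 (Nat.pos_of_ne_zero hm)
  have h0 := (F.2.differentiableOn.analyticOnNhd isOpen_univ
    ).eqOn_zero_of_preconnected_of_frequently_eq_zero isPreconnected_univ (Set.mem_univ z) hfreq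
  refine hF (Subtype.ext (ContinuousMap.ext fun w => ?_))
  rw [h0 (Set.mem_univ w)]
  simp [toEntire]

lemma zeroMeasure_apply (F : ℂ → ℂ) {s : Set ℂ} (hs : MeasurableSet s) :
    zeroMeasure F s = ∑' z, s.indicator (fun z => ((analyticOrderAt F z : ℕ∞) : ℝ≥0∞)) z := by
  rw [zeroMeasure, Measure.sum_apply _ hs]
  have e : ∀ z : {z : ℂ // F z = 0},
      (((analyticOrderAt F (z : ℂ) : ℕ∞) : ℝ≥0∞) • Measure.dirac (z : ℂ)) s =
        s.indicator (fun z => ((analyticOrderAt F z : ℕ∞) : ℝ≥0∞)) z := fun z => by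
    rw [Measure.smul_apply, Measure.dirac_apply' _ hs, smul_eq_mul]
    by_cases h : (z : ℂ) ∈ s <;> simp [h]
  simp_rw [e]
  refine tsum_subtype_eq_of_support_subset (s := {z | F z = 0})
    (f := s.indicator (fun z => ((analyticOrderAt F z : ℕ∞) : ℝ≥0∞))) fun z hz => ?_
  by_contra hne
  refine hz ?_
  have : analyticOrderAt F z = 0 := analyticOrderAt_eq_zero.2 (.inr hne)
  by_cases h : z ∈ s <;> simp [h, this]

lemma tsum_ite_succ_le (n : ℕ∞) :
    ∑' m : ℕ, (if ((m + 1 : ℕ) : ℕ∞) ≤ n then (1 : ℝ≥0∞) else 0) = n := by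
  induction n using ENat.recTopCoe with
  | top => simp
  | coe n =>
    rw [tsum_eq_sum (s := Finset.range n) fun m hm => by
      rw [Finset.mem_range] at hm
      rw [if_neg (by exact_mod_cast (by omega : ¬ m + 1 ≤ n))]]
    rw [Finset.sum_congr rfl fun m hm => if_pos (by
      rw [Finset.mem_range] at hm
      exact_mod_cast (by omega : m + 1 ≤ n))]
    simp

/-- Layer-cake decomposition of the zero measure by multiplicity. -/
lemma zeroMeasure_eq_sum (F : EntireFunction) :
    zeroMeasure F.1 =
      Measure.sum fun m : ℕ => Measure.count.restrict (zerosOfOrder (m + 1) F.1) := by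
  ext s hs
  rw [zeroMeasure_apply _ hs, Measure.sum_apply _ hs]
  have e : ∀ m : ℕ, Measure.count.restrict (zerosOfOrder (m + 1) F.1) s =
      ∑' z, s.indicator (fun z =>
        if ((m + 1 : ℕ) : ℕ∞) ≤ analyticOrderAt F.1 z then (1 : ℝ≥0∞) else 0) z := fun m => by
    have hc := (isClosed_zerosOfOrder (m + 1) F).measurableSet
    rw [Measure.restrict_apply hs, Measure.count, Measure.sum_apply _ (hs.inter hc)]
    congr 1; ext z
    rw [Measure.dirac_apply' _ (hs.inter hc)]
    by_cases h : z ∈ s <;> by_cases h' : ((m + 1 : ℕ) : ℕ∞) ≤ analyticOrderAt F.1 z <;>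
      simp_all [zerosOfOrder, Set.indicator]
  simp_rw [e]
  rw [ENNReal.tsum_comm]
  congr 1; ext z
  by_cases h : z ∈ s
  · simp only [Set.indicator_of_mem h]
    exact (tsum_ite_succ_le _).symm
  · simp [h]

/-- The collection of zeros, with multiplicities, is a measurable function of an entire function. -/
lemma measurable_zeroMeasure : Measurable fun F : EntireFunction => zeroMeasure F.1 := by
  refine measurable_of_measurable_on_compl_singleton (toEntire 0) ?_
  change Measurable fun F : {F : EntireFunction | F ≠ toEntire 0} => zeroMeasure F.1.1
  simp_rw [zeroMeasure_eq_sum]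
  have hm : ∀ m : ℕ, Measurable fun F : {F : EntireFunction | F ≠ toEntire 0} =>
      Measure.count.restrict (zerosOfOrder (m + 1) F.1.1) := fun m =>
    measurable_count_restrict (fun F => isClosed_zerosOfOrder _ F.1)
      (fun K hK => measurable_subtype_coe (measurableSet_zerosOfOrder_inter_nonempty (m + 1) hK))
      (fun F K hK => finite_zerosOfOrder_inter m.succ_ne_zero F.2 hK)
  refine Measure.measurable_of_measurable_coe _ fun s hs => ?_
  simp_rw [Measure.sum_apply _ hs]
  exact .tsum fun m => (Measure.measurable_coe hs).comp (hm m)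

/-- Multiplication by a nowhere vanishing function does not change the zeros, and a dilation of the
argument dilates them. -/
lemma scaledZeroMeasure_eq_zeroMeasure {F p : ℂ → ℂ} (hF : Differentiable ℂ F)
    (hp : Differentiable ℂ p) (hp0 : ∀ z, p z ≠ 0) {s : ℝ} (hs : s ≠ 0) :
    scaledZeroMeasure s F = zeroMeasure fun z => p z * F (z * s) := by
  have hsC : (s : ℂ) ≠ 0 := by exact_mod_cast hs
  have hdiv : Measurable fun z : ℂ => z / (s : ℂ) := by fun_prop
  ext B hB
  rw [scaledZeroMeasure, Measure.map_apply hdiv hB, zeroMeasure_apply _ hB,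
    zeroMeasure_apply _ (hdiv hB), ← (Equiv.mulRight₀ (s : ℂ) hsC).tsum_eq]
  congr 1; ext z
  have hord : analyticOrderAt (fun z => p z * F (z * s)) z = analyticOrderAt F (z * s) := by
    have hcomp := analyticOrderAt_comp_of_deriv_ne_zero (f := F) (g := fun z : ℂ => z * (s : ℂ))
      (z₀ := z) (by fun_prop) (by simpa using hsC)
    have hFs : Differentiable ℂ (F ∘ fun z : ℂ => z * (s : ℂ)) := hF.comp (by fun_prop)
    have hmul := analyticOrderAt_mul (hp.analyticAt z) (hFs.analyticAt z)
    rw [hcomp, ((hp.analyticAt z).analyticOrderAt_eq_zero).2 (hp0 z), zero_add] at hmul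
    exact hmul
  by_cases h : z ∈ B <;> simp [h, hord, Set.indicator, hsC]

/-! ### Equality in law -/

lemma toEntire_apply {F : ℂ → ℂ} (hF : Differentiable ℂ F) : ((toEntire F).1 : ℂ → ℂ) = F := by
  have h : toEntire F = ⟨⟨F, hF.continuous⟩, hF⟩ := dif_pos hF
  rw [h]; rfl

section Series

variable {Ω : Type*} [MeasurableSpace Ω] {P : Measure Ω} {ξ : ℕ → Ω → ℂ}

lemma aemeasurable_toEntire_eval_of_hasSum (hξ : ∀ n, AEMeasurable (ξ n) P) {X : Ω → ℂ → ℂ}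
    {φ : ℕ → ℂ → ℂ} (hX : ∀ᵐ ω ∂P, Differentiable ℂ (X ω))
    (hsum : ∀ᵐ ω ∂P, ∀ z, HasSum (fun m => ξ m ω * φ m z) (X ω z)) (z : ℂ) :
    AEMeasurable (fun ω => (toEntire (X ω)).1 z) P := by
  refine aemeasurable_of_tendsto_metrizable_ae atTop
    (f := fun N ω => ∑ m ∈ Finset.range N, ξ m ω * φ m z)
    (fun N => Finset.aemeasurable_fun_sum _ fun m _ => (hξ m).mul_const _) ?_
  filter_upwards [hX, hsum] with ω h1 h2
  rw [toEntire_apply h1]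
  exact (h2 z).tendsto_sum_nat

/-- Two Gaussian series of entire functions with the same reproducing kernel have the same law as
random entire functions. -/
lemma identDistrib_toEntire_of_kernel_eq [IsProbabilityMeasure P] (hindep : iIndepFun ξ P)
    (hlaw : ∀ n, HasLaw (ξ n) stdComplexGaussian P) {X Y : Ω → ℂ → ℂ} {φ ψ : ℕ → ℂ → ℂ}
    {K : ℂ → ℂ → ℂ} (hX : ∀ᵐ ω ∂P, Differentiable ℂ (X ω)) (hY : ∀ᵐ ω ∂P, Differentiable ℂ (Y ω))
    (hXs : ∀ᵐ ω ∂P, ∀ z, HasSum (fun m => ξ m ω * φ m z) (X ω z))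
    (hYs : ∀ᵐ ω ∂P, ∀ z, HasSum (fun m => ξ m ω * ψ m z) (Y ω z))
    (hφ : ∀ z w, HasSum (fun m => φ m z * conj (φ m w)) (K z w))
    (hψ : ∀ z w, HasSum (fun m => ψ m z * conj (ψ m w)) (K z w)) :
    IdentDistrib (fun ω => toEntire (X ω)) (fun ω => toEntire (Y ω)) P P := by
  have hξ : ∀ n, AEMeasurable (ξ n) P := fun n => (hlaw n).aemeasurable
  have hXm := aemeasurable_toEntire_eval_of_hasSum hξ hX hXs
  have hYm := aemeasurable_toEntire_eval_of_hasSum hξ hY hYs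
  refine identDistrib_entireFunction_of_eval hXm hYm fun I d => ?_
  refine map_eq_map_of_hasSum_of_kernel_eq hindep hlaw (φ := fun m i => φ m (d i))
    (ψ := fun m i => ψ m (d i)) (K := fun i j => K (d i) (d j)) (fun i j => hφ _ _)
    (fun i j => hψ _ _) (aemeasurable_pi_iff.2 fun i => hXm _)
    (aemeasurable_pi_iff.2 fun i => hYm _) ?_ ?_
  · filter_upwards [hX, hXs] with ω h1 h2 i
    rw [toEntire_apply h1]; exact h2 _
  · filter_upwards [hY, hYs] with ω h1 h2 i
    rw [toEntire_apply h1]; exact h2 _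

end Series

end

theorem theorem1p1 {Ω : Type*} [MeasurableSpace Ω] (P : Measure Ω) [IsProbabilityMeasure P]
    (ξ : ℕ → Ω → ℂ) (hindep : iIndepFun ξ P)
    (hlaw : ∀ n, HasLaw (ξ n) stdComplexGaussian P)
    (G : Ω → ℂ → ℂ) (hG : ∀ ω, G ω = planeGAF (fun n => ξ n ω))
    (τ : ℂ) (hτ : ‖τ‖ < 1) :
    -- almost surely, `G` and `V_τ G` are well-defined entire functions
    (∀ᵐ ω ∂P,
      (∀ z : ℂ, Summable fun n : ℕ => ξ n ω * (z ^ n / (Real.sqrt (n.factorial : ℝ) : ℂ))) ∧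
      Differentiable ℂ (G ω) ∧
      (∀ z : ℂ, Summable (heatTerm τ (G ω) z)) ∧
      Differentiable ℂ (heatFlow τ (G ω)) ∧
      Differentiable ℂ (heatV τ (G ω))) ∧
    -- `V_τ G` and `G` have the same law as random entire functions
    IdentDistrib (fun ω => toEntire (heatV τ (G ω))) (fun ω => toEntire (G ω)) P P ∧
    -- the zeros of `e^{-τ D²/2} G`, divided by `√(1 - |τ|²)`, are the zeros of `V_τ G`
    (∀ᵐ ω ∂P,
      scaledZeroMeasure (heatScale τ) (heatFlow τ (G ω)) = zeroMeasure (heatV τ (G ω))) ∧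
    -- and these point processes have the same law as the zeros of `G`
    IdentDistrib (fun ω => zeroMeasure (heatV τ (G ω))) (fun ω => zeroMeasure (G ω)) P P ∧
    IdentDistrib (fun ω => scaledZeroMeasure (heatScale τ) (heatFlow τ (G ω)))
      (fun ω => zeroMeasure (G ω)) P P := by
  obtain ⟨A, hA, hAτ⟩ := exists_one_lt_sq_mul_lt_one hτ
  have hA0 : 0 ≤ A := by linarith
  have hD : 0 < 1 - ‖τ‖ ^ 2 := by nlinarith [norm_nonneg τ]
  have hgrowth := ae_exists_growth hlaw hA
  have hentire : ∀ᵐ ω ∂P, Differentiable ℂ (G ω) := by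
    filter_upwards [hgrowth] with ω ⟨C, hC⟩
    rw [hG]; exact differentiable_planeGAF hA0 hC
  have hflow : ∀ᵐ ω ∂P, Differentiable ℂ (heatFlow τ (G ω)) := by
    filter_upwards [hgrowth] with ω ⟨C, hC⟩
    rw [hG]; exact differentiable_heatFlow_planeGAF hA0 hC hAτ
  have hV : ∀ᵐ ω ∂P, Differentiable ℂ (heatV τ (G ω)) :=
    hflow.mono fun ω h => differentiable_heatV h
  have hlawV : IdentDistrib (fun ω => toEntire (heatV τ (G ω))) (fun ω => toEntire (G ω)) P P := by
    refine identDistrib_toEntire_of_kernel_eq hindep hlaw hV hentire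
      (φ := fun m => heatV τ (gafBasis m)) (ψ := gafBasis) ?_ ?_
      (hasSum_heatV_mul_conj_heatV hτ) hasSum_gafBasis_mul_conj_gafBasis
    · filter_upwards [hgrowth] with ω ⟨C, hC⟩ z
      rw [hG]; exact hasSum_heatV_planeGAF hA0 hC hAτ z
    · filter_upwards [hgrowth] with ω ⟨C, hC⟩ z
      rw [hG]; exact hasSum_planeGAF hA0 hC z
  have hscaled : ∀ᵐ ω ∂P,
      scaledZeroMeasure (heatScale τ) (heatFlow τ (G ω)) = zeroMeasure (heatV τ (G ω)) := by
    filter_upwards [hflow] with ω h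
    refine scaledZeroMeasure_eq_zeroMeasure h (p := fun z =>
      (((1 - ‖τ‖ ^ 2) ^ (1 / 4 : ℝ) : ℝ) : ℂ) * Complex.exp ((starRingEnd ℂ) τ * z ^ 2 / 2))
      (by fun_prop) (fun z => ?_) (Real.sqrt_pos.2 hD).ne'
    exact mul_ne_zero (by exact_mod_cast (Real.rpow_pos_of_pos hD _).ne') (Complex.exp_ne_zero _)
  have hzeros : IdentDistrib (fun ω => zeroMeasure (heatV τ (G ω)))
      (fun ω => zeroMeasure (G ω)) P P := by
    have h := hlawV.comp measurable_zeroMeasure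
    have h1 : (fun ω => zeroMeasure (toEntire (heatV τ (G ω))).1) =ᵐ[P]
        fun ω => zeroMeasure (heatV τ (G ω)) := by
      filter_upwards [hV] with ω h
      rw [toEntire_apply h]
    have h2 : (fun ω => zeroMeasure (toEntire (G ω)).1) =ᵐ[P] fun ω => zeroMeasure (G ω) := by
      filter_upwards [hentire] with ω h
      rw [toEntire_apply h]
    exact ((IdentDistrib.of_ae_eq h.aemeasurable_fst h1).symm.trans h).trans
      (IdentDistrib.of_ae_eq h.aemeasurable_snd h2)
  refine ⟨?_, hlawV, hscaled, hzeros, ?_⟩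
  · filter_upwards [hgrowth, hentire, hflow, hV] with ω ⟨C, hC⟩ h1 h2 h3
    refine ⟨summable_planeGAF hA0 hC, h1, ?_, h2, h3⟩
    rw [hG]; exact summable_heatTerm_planeGAF hA0 hC hAτ
  · have hscaled' : (fun ω => zeroMeasure (heatV τ (G ω))) =ᵐ[P]
        fun ω => scaledZeroMeasure (heatScale τ) (heatFlow τ (G ω)) :=
      hscaled.mono fun ω h => h.symm
    exact (IdentDistrib.of_ae_eq hzeros.aemeasurable_fst hscaled').symm.trans hzeros
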